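/- Equip $\mathbb E^3_1=\mathbb R^3$ with $\langle v,w\rangle=-v_1w_1+v_2w_2+v_3w_3$, let $v\wedge w$ be the vector with $\langle v\wedge w,z\rangle=\det(v,w,z)$ for all $z$, and let $\mathbb S^2_1(1)=\{y:\langle y,y\rangle=1\}$. Let $M$ be a smooth surface, $x:M\to\mathbb E^3_1$ a smooth space-like immersion (the induced metric is positive definite) with smooth unit normal field $N$ ($\langle N,N\rangle=-1$), and shape operator $S$ given by $dN=-dx\circ S$. Assume that $M$ lies in the space-like cone, i.e. $\langle x,x\rangle>0$ on $M$. The surface $M$ is called a generalized constant ratio (GCR) surface if at every point the tangential part $x^T=x+\langle x,N\rangle N$ of the position vector is a principal direction (an eigenvector of $S$). By a parametrization of type $(*)$ we mean a smooth local parametrization of an open part of $M$ by $(s,t)\in(a,b)\times(c,d)$, $a<b$, $c<d$, in which $$x(s,t)=s\bigl(\cosh u(s)\,\varphi(t)+\sinh u(s)\,\varphi(t)\wedge\varphi'(t)\bigr),\qquad (*)$$ where $u$ is a smooth function on $(a,b)$ and $\varphi:(c,d)\to\mathbb S^2_1(1)$ is a smooth curve parametrized by arc length, $\langle\varphi',\varphi'\rangle=1$.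 Then: 1. $M$ is a GCR surface if and only if every point of $M$ lies in the image of a parametrization of type $(*)$. 2. For every parametrization of type $(*)$ there is a smooth function $\theta=\theta(s)$ with $\tanh\theta=s\,u'(s)$ such that, for one of the two choices $\pm N$ of the unit normal, denoted again by $N$, $$x=s\,(\cosh\theta\,e_1+\sinh\theta\,N)\qquad(**)$$ on the image, where $e_1$ is a unit tangent vector in a principal direction. 3. If $M$ is a GCR surface, then around every point the parametrization $(*)$ can be chosen with $s>0$ and such that $(**)$ holds with the given unit normal $N$. -/

import Mathlib

open scoped Manifold ContDiff

noncomputable section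

namespace Minkowski

/-- The underlying vector space of Minkowski 3-space. -/
abbrev E31 : Type := Fin 3 → ℝ

/-- The Minkowski metric `-dx₁² + dx₂² + dx₃²`. -/
def ip (v w : E31) : ℝ := -(v 0 * w 0) + v 1 * w 1 + v 2 * w 2

/-- The Lorentzian cross product; `ip_wedge` and `wedge_unique` are its defining property. -/
def wedge (v w : E31) : E31 :=
  ![-(v 1 * w 2 - v 2 * w 1), v 2 * w 0 - v 0 * w 2, v 0 * w 1 - v 1 * w 0]

/-- `⟨v ∧ w, z⟩` is the determinant of the matrix with columns `v`, `w`, `z`. -/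
theorem ip_wedge (v w z : E31) :
    ip (wedge v w) z = (Matrix.of ![v, w, z]).transpose.det := by
  simp [ip, wedge, Matrix.det_fin_three]
  ring

theorem wedge_unique (v w y : E31)
    (h : ∀ z, ip y z = (Matrix.of ![v, w, z]).transpose.det) : y = wedge v w := by
  have h' : ∀ z, ip y z = ip (wedge v w) z := fun z => by rw [h, ip_wedge]
  have h0 := h' ![1, 0, 0]
  have h1 := h' ![0, 1, 0]
  have h2 := h' ![0, 0, 1]
  simp [ip] at h0 h1 h2
  ext i
  fin_cases i
  · exact h0
  · exact h1
  · exact h2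

section Surface

variable {M : Type*} [TopologicalSpace M] [ChartedSpace (EuclideanSpace ℝ (Fin 2)) M]

/-- The differential of a map from a surface to Minkowski space; its values are regarded as
vectors of Minkowski space. -/
def differential (x : M → E31) (p : M) : TangentSpace (𝓡 2) p →L[ℝ] E31 :=
  mfderiv (𝓡 2) 𝓘(ℝ, E31) x p

/-- `x : M → E³₁` is a smooth space-like immersion: the induced metric is positive definite
(in particular the differential of `x` is injective at each point). -/
structure IsSpacelikeImmersion (x : M → E31) : Prop where
  smooth : ContMDiff (𝓡 2) 𝓘(ℝ, E31) ∞ x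
  pos : ∀ (p : M) (v : TangentSpace (𝓡 2) p), v ≠ 0 →
    0 < ip (differential x p v) (differential x p v)

/-- `N` is a smooth unit normal vector field of the space-like surface `x` (an orientation);
it is time-like, so "unit" means `⟨N, N⟩ = -1`. -/
structure IsUnitNormal (x N : M → E31) : Prop where
  smooth : ContMDiff (𝓡 2) 𝓘(ℝ, E31) ∞ N
  unit : ∀ p : M, ip (N p) (N p) = -1
  normal : ∀ (p : M) (v : TangentSpace (𝓡 2) p), ip (N p) (differential x p v) = 0

/-- The tangential part `x^T` of the position vector at `p`; since `⟨N, N⟩ = -1`, the normal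
part is `-⟨x, N⟩ N`. -/
def tangentialPart (x N : M → E31) (p : M) : E31 := x p + ip (x p) (N p) • N p

/-- Weingarten formula: `S` is the shape operator at `p`, i.e. `dN = -dx ∘ S`. -/
def IsShapeOperator (x N : M → E31) (p : M) (S : Module.End ℝ (TangentSpace (𝓡 2) p)) : Prop :=
  ∀ v : TangentSpace (𝓡 2) p, differential N p v = -differential x p (S v)

/-- `v` is a principal direction at `p`: an eigenvector of the shape operator. -/
def IsPrincipalDirection (x N : M → E31) (p : M) (v : TangentSpace (𝓡 2) p) : Prop :=
  ∃ S : Module.End ℝ (TangentSpace (𝓡 2) p),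
    IsShapeOperator x N p S ∧ ∃ k : ℝ, S.HasEigenvector k v

/-- Generalized constant ratio surface: at each point the tangential part of the position vector
is a principal direction. -/
def IsGCR (x N : M → E31) : Prop :=
  ∀ p : M, ∃ v : TangentSpace (𝓡 2) p,
    differential x p v = tangentialPart x N p ∧ IsPrincipalDirection x N p v

/-- `f` is a smooth local parametrization of the surface, defined on
`(a, b) × (c, d)` and with open image, in which
`x(s,t) = s (cosh u(s) φ(t) + sinh u(s) φ(t) ∧ φ'(t))`, where `u` is smooth and `φ` is a smooth
curve parametrized by arc length in the de Sitter surface `⟨y, y⟩ = 1`. -/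
structure IsConicParametrization (x : M → E31) (f : OpenPartialHomeomorph (ℝ × ℝ) M)
    (a b c d : ℝ) (u : ℝ → ℝ) (φ : ℝ → E31) : Prop where
  lt_left : a < b
  lt_right : c < d
  source_eq : f.source = Set.Ioo a b ×ˢ Set.Ioo c d
  smooth : ContMDiffOn 𝓘(ℝ, ℝ × ℝ) (𝓡 2) ∞ f f.source
  smooth_symm : ContMDiffOn (𝓡 2) 𝓘(ℝ, ℝ × ℝ) ∞ f.symm f.target
  smooth_u : ContDiffOn ℝ ∞ u (Set.Ioo a b)
  smooth_curve : ContDiffOn ℝ ∞ φ (Set.Ioo c d)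
  deSitter : ∀ t ∈ Set.Ioo c d, ip (φ t) (φ t) = 1
  arclength : ∀ t ∈ Set.Ioo c d, ip (deriv φ t) (deriv φ t) = 1
  eq : ∀ s ∈ Set.Ioo a b, ∀ t ∈ Set.Ioo c d,
    x (f (s, t)) = s • (Real.cosh (u s) • φ t + Real.sinh (u s) • wedge (φ t) (deriv φ t))

/-- In the coordinates `f`, `x = s (cosh θ e₁ + sinh θ N)` with `θ = θ(s)` smooth,
`tanh θ = s u'(s)`, and `e₁ = dx(v)` a unit tangent vector in a principal direction. -/
def HasDecomposition (x N : M → E31) (f : OpenPartialHomeomorph (ℝ × ℝ) M)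
    (a b c d : ℝ) (u : ℝ → ℝ) : Prop :=
  ∃ θ : ℝ → ℝ, ContDiffOn ℝ ∞ θ (Set.Ioo a b) ∧
    (∀ s ∈ Set.Ioo a b, Real.tanh (θ s) = s * deriv u s) ∧
    ∀ s ∈ Set.Ioo a b, ∀ t ∈ Set.Ioo c d,
      ∃ v : TangentSpace (𝓡 2) (f (s, t)),
        ip (differential x (f (s, t)) v) (differential x (f (s, t)) v) = 1 ∧
        IsPrincipalDirection x N (f (s, t)) v ∧
        x (f (s, t)) = s • (Real.cosh (θ s) • differential x (f (s, t)) v +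
          Real.sinh (θ s) • N (f (s, t)))

end Surface

end Minkowski

end

/-!
Write `n` for the unit normal, `g = ⟨x, n⟩`, and let `e` be the binormal, the unit vector
`n ∧ x / √(⟨x, x⟩ + g²)`, which is tangent to the surface and orthogonal to `x`.

A conic parametrization `x = s (cosh u φ + sinh u φ ∧ φ')` comes with the moving frame
`y = cosh u φ + sinh u φ ∧ φ'`, `z = sinh u φ + cosh u φ ∧ φ'`, with `x = s y`, `y_s = u' z` and
`z_s = u' y`. The first coordinate vector is `y + s u' z`; it is space-like, so `s u' = tanh θ`
for a smooth `θ`. The unit normals are `±(sinh θ y + cosh θ z)`, with a constant sign on the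
connected rectangle, and their derivative along `s` is a multiple of `e₁ = cosh θ y + sinh θ z`,
the normalized first coordinate vector. So `e₁` is a principal direction
(`IsConicParametrization.hasDecomposition_or`). The tangential part of `x` is a multiple of `e₁`,
so a surface covered by such parametrizations is a GCR surface (`isGCR_of_conic`).

Conversely, let the surface be GCR. Then the derivative of `e` in the direction of the tangential
part of `x` is orthogonal to `x`, `n` and `e`, so it vanishes
(`IsSmoothParam.fderiv_binormal_eq_zero`). By the inverse function theorem, `s = √⟨x, x⟩` and
`r = -⟨e, x(p)⟩` are coordinates near the point `p` (`exists_isAdapted`). The tangential part of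
`x` does not change `r`, so it points in the direction of `∂/∂s`, and `e` depends on `r` only. By
self-adjointness of the shape operator, `g` depends on `s` only, and one may define `θ(s)` by
`g = -s sinh θ` and `u(s)` by `s u' = tanh θ`, `u(s₀) = 0`. Now `y = x / s` and `z = y ∧ e`
satisfy `y_s = u' z` and `z_s = u' y`, so `cosh u y - sinh u z` is independent of `s`. Its value
at `s₀` is the curve `φ = x / s₀` on `s = s₀`, and solving for `x` gives the conic form, up to the
parameter of `φ` (`IsAdapted.position_eq`). The velocity of `φ` is a positive multiple of `e` near
`r(p)`, and a second use of the inverse function theorem replaces `r` by arc length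
(`IsGCR.exists_conic`).
-/

noncomputable section

namespace Minkowski

/-! ### Algebra of the Lorentzian inner and cross products -/

theorem ip_comm (v w : E31) : ip v w = ip w v := by simp only [ip]; ring

theorem ip_add_left (v v' w : E31) : ip (v + v') w = ip v w + ip v' w := by
  simp only [ip, Pi.add_apply]; ring

theorem ip_add_right (v w w' : E31) : ip v (w + w') = ip v w + ip v w' := by
  simp only [ip, Pi.add_apply]; ring

theorem ip_smul_left (c : ℝ) (v w : E31) : ip (c • v) w = c * ip v w := by
  simp only [ip, Pi.smul_apply, smul_eq_mul]; ring

theorem ip_smul_right (c : ℝ) (v w : E31) : ip v (c • w) = c * ip v w := by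
  simp only [ip, Pi.smul_apply, smul_eq_mul]; ring

theorem ip_neg_left (v w : E31) : ip (-v) w = -ip v w := by
  simp only [ip, Pi.neg_apply]; ring

theorem ip_neg_right (v w : E31) : ip v (-w) = -ip v w := by
  simp only [ip, Pi.neg_apply]; ring

theorem ip_zero_left (w : E31) : ip 0 w = 0 := by simp [ip]

theorem wedge_smul_left (c : ℝ) (v w : E31) : wedge (c • v) w = c • wedge v w := by
  ext i; fin_cases i <;> simp [wedge] <;> ring

theorem wedge_smul_right (c : ℝ) (v w : E31) : wedge v (c • w) = c • wedge v w := by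
  ext i; fin_cases i <;> simp [wedge] <;> ring

theorem wedge_add_left (v v' w : E31) : wedge (v + v') w = wedge v w + wedge v' w := by
  ext i; fin_cases i <;> simp [wedge] <;> ring

theorem wedge_self (v : E31) : wedge v v = 0 := by
  ext i; fin_cases i <;> simp [wedge] <;> ring

theorem wedge_anticomm (v w : E31) : wedge v w = -wedge w v := by
  ext i; fin_cases i <;> simp [wedge] <;> ring

theorem ip_wedge_left_self (v w : E31) : ip (wedge v w) v = 0 := by
  simp [ip, wedge]; ring

theorem ip_wedge_right_self (v w : E31) : ip (wedge v w) w = 0 := by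
  simp [ip, wedge]; ring

/-- Triple product expansion; the signs are opposite to the Euclidean ones. -/
theorem wedge_wedge (a b c : E31) : wedge a (wedge b c) = ip a b • c - ip a c • b := by
  ext i; fin_cases i <;> simp [wedge, ip] <;> ring

/-- Lagrange identity; the sign is opposite to the Euclidean one. -/
theorem ip_wedge_wedge (a b c d : E31) :
    ip (wedge a b) (wedge c d) = -(ip a c * ip b d - ip a d * ip b c) := by
  simp [wedge, ip]; ring

/-- A vector orthogonal to `a` and `b` is a multiple of `a ∧ b`, provided the plane spanned by
`a` and `b` is nondegenerate. -/
theorem eq_smul_wedge {a b v : E31} (ha : ip v a = 0) (hb : ip v b = 0)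
    (hm : ip (wedge a b) (wedge a b) ≠ 0) :
    v = (ip (wedge a b) v / ip (wedge a b) (wedge a b)) • wedge a b := by
  have h1 : wedge v (wedge a b) = 0 := by rw [wedge_wedge, ha, hb]; simp
  have h2 : wedge (wedge a b) (wedge (wedge a b) v) = 0 := by
    rw [wedge_anticomm (wedge a b) v, h1]; ext i; fin_cases i <;> simp [wedge]
  rw [wedge_wedge, sub_eq_zero] at h2
  rw [div_eq_inv_mul, mul_smul, ← h2, smul_smul, inv_mul_cancel₀ hm, one_smul]

/-- Two time-like unit normals of the same space-like plane agree up to sign. -/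
theorem unit_normal_unique {a b n m : E31} (hm : 0 < ip a a * ip b b - ip a b * ip a b)
    (hn : ip n n = -1) (hna : ip n a = 0) (hnb : ip n b = 0)
    (hm' : ip m m = -1) (hma : ip m a = 0) (hmb : ip m b = 0) :
    ip n m ^ 2 = 1 ∧ n = -ip n m • m := by
  have hk : ip (wedge a b) (wedge a b) ≠ 0 := by
    rw [ip_wedge_wedge, ip_comm b a]; linarith
  obtain ⟨α, hα⟩ : ∃ α : ℝ, n = α • wedge a b := ⟨_, eq_smul_wedge hna hnb hk⟩
  obtain ⟨β, hβ⟩ : ∃ β : ℝ, m = β • wedge a b := ⟨_, eq_smul_wedge hma hmb hk⟩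
  set k := ip (wedge a b) (wedge a b)
  have h1 : α * (α * k) = -1 := by rw [← hn, hα, ip_smul_left, ip_smul_right]
  have h2 : β * (β * k) = -1 := by rw [← hm', hβ, ip_smul_left, ip_smul_right]
  have h3 : ip n m = α * (β * k) := by rw [hα, hβ, ip_smul_left, ip_smul_right]
  refine ⟨by rw [h3]; linear_combination (α ^ 2 * k) * h2 - h1, ?_⟩
  rw [h3, hα, hβ, smul_smul]
  congr 1
  linear_combination α * h2

/-! ### Differentiating inner and cross products -/

theorem _root_.HasDerivAt.ip {f g : ℝ → E31} {f' g' : E31} {t : ℝ} (hf : HasDerivAt f f' t)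
    (hg : HasDerivAt g g' t) :
    HasDerivAt (fun τ => ip (f τ) (g τ)) (ip f' (g t) + ip (f t) g') t := by
  rw [hasDerivAt_pi] at hf hg
  refine ((((hf 0).mul (hg 0)).neg.add ((hf 1).mul (hg 1))).add
    ((hf 2).mul (hg 2))).congr_deriv ?_
  simp only [Minkowski.ip]; ring

theorem _root_.HasDerivAt.wedge {f g : ℝ → E31} {f' g' : E31} {t : ℝ} (hf : HasDerivAt f f' t)
    (hg : HasDerivAt g g' t) :
    HasDerivAt (fun τ => wedge (f τ) (g τ)) (wedge f' (g t) + wedge (f t) g') t := by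
  rw [hasDerivAt_pi] at hf hg ⊢
  intro i
  fin_cases i
  · refine (((hf 1).mul (hg 2)).sub ((hf 2).mul (hg 1))).neg.congr_deriv ?_
    simp [Minkowski.wedge]; ring
  · refine (((hf 2).mul (hg 0)).sub ((hf 0).mul (hg 2))).congr_deriv ?_
    simp [Minkowski.wedge]; ring
  · refine (((hf 0).mul (hg 1)).sub ((hf 1).mul (hg 0))).congr_deriv ?_
    simp [Minkowski.wedge]; ring

section Smooth

variable {E : Type*} [NormedAddCommGroup E] [NormedSpace ℝ E] {s : Set E}

theorem _root_.ContDiffOn.ip {f g : E → E31} (hf : ContDiffOn ℝ ∞ f s) (hg : ContDiffOn ℝ ∞ g s) :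
    ContDiffOn ℝ ∞ (fun q => ip (f q) (g q)) s := by
  rw [contDiffOn_pi] at hf hg
  exact (((hf 0).mul (hg 0)).neg.add ((hf 1).mul (hg 1))).add ((hf 2).mul (hg 2))

theorem _root_.ContDiffOn.wedge {f g : E → E31} (hf : ContDiffOn ℝ ∞ f s)
    (hg : ContDiffOn ℝ ∞ g s) : ContDiffOn ℝ ∞ (fun q => wedge (f q) (g q)) s := by
  rw [contDiffOn_pi] at hf hg ⊢
  intro i
  fin_cases i
  · exact (((hf 1).mul (hg 2)).sub ((hf 2).mul (hg 1))).neg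
  · exact ((hf 2).mul (hg 0)).sub ((hf 0).mul (hg 2))
  · exact ((hf 0).mul (hg 1)).sub ((hf 1).mul (hg 0))

end Smooth

/-! ### Calculus on intervals and rectangles -/

/-- A smooth function on an open interval has a smooth antiderivative vanishing at a given
point. -/
theorem exists_smooth_antideriv {g : ℝ → ℝ} {a b s₀ : ℝ} (hs₀ : s₀ ∈ Set.Ioo a b)
    (hg : ContDiffOn ℝ ∞ g (Set.Ioo a b)) :
    ∃ G : ℝ → ℝ, ContDiffOn ℝ ∞ G (Set.Ioo a b) ∧ G s₀ = 0 ∧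
      ∀ s ∈ Set.Ioo a b, HasDerivAt G (g s) s := by
  have hd : ∀ s ∈ Set.Ioo a b, HasDerivAt (fun s => ∫ τ in s₀..s, g τ) (g s) s := by
    intro s hs
    have hsub : Set.uIcc s₀ s ⊆ Set.Ioo a b := by
      rw [Set.uIcc_eq_union]
      exact Set.union_subset (Set.Icc_subset_Ioo hs₀.1 hs.2) (Set.Icc_subset_Ioo hs.1 hs₀.2)
    exact intervalIntegral.integral_hasDerivAt_right (hg.continuousOn.mono hsub).intervalIntegrable
      (hg.continuousOn.stronglyMeasurableAtFilter isOpen_Ioo s hs)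
      (hg.continuousOn.continuousAt (isOpen_Ioo.mem_nhds hs))
  refine ⟨_, ?_, intervalIntegral.integral_same, hd⟩
  rw [contDiffOn_infty_iff_deriv_of_isOpen isOpen_Ioo]
  exact ⟨fun s hs => (hd s hs).differentiableAt.differentiableWithinAt,
    hg.congr fun s hs => (hd s hs).deriv⟩

theorem eq_of_hasDerivAt_zero {E : Type*} [NormedAddCommGroup E] [NormedSpace ℝ E]
    {g : ℝ → E} {a b : ℝ} (hg : ∀ s ∈ Set.Ioo a b, HasDerivAt g 0 s) {s s' : ℝ}
    (hs : s ∈ Set.Ioo a b) (hs' : s' ∈ Set.Ioo a b) : g s = g s' :=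
  isOpen_Ioo.is_const_of_deriv_eq_zero isPreconnected_Ioo
    (fun s hs => (hg s hs).differentiableAt.differentiableWithinAt)
    (fun s hs => (hg s hs).deriv) hs hs'

theorem hasDerivAt_line {E F : Type*} [NormedAddCommGroup E] [NormedSpace ℝ E]
    [NormedAddCommGroup F] [NormedSpace ℝ F] {g : E → F} {q : E} (hg : DifferentiableAt ℝ g q)
    (v : E) : HasDerivAt (fun τ : ℝ => g (q + τ • v)) (fderiv ℝ g q v) 0 := by
  have h1 : HasDerivAt (fun τ : ℝ => q + τ • v) v 0 := by
    simpa using ((hasDerivAt_id (0 : ℝ)).smul_const v).const_add q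
  have h2 : HasFDerivAt g (fderiv ℝ g q) (q + (0 : ℝ) • v) := by simpa using hg.hasFDerivAt
  exact h2.comp_hasDerivAt 0 h1

theorem hasDerivAt_fst {F : Type*} [NormedAddCommGroup F] [NormedSpace ℝ F] {g : ℝ × ℝ → F}
    {s r : ℝ} (hg : DifferentiableAt ℝ g (s, r)) :
    HasDerivAt (fun σ : ℝ => g (σ, r)) (fderiv ℝ g (s, r) (1, 0)) s :=
  hg.hasFDerivAt.comp_hasDerivAt s ((hasDerivAt_id s).prodMk (hasDerivAt_const s r))

theorem hasDerivAt_snd {F : Type*} [NormedAddCommGroup F] [NormedSpace ℝ F] {g : ℝ × ℝ → F}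
    {s r : ℝ} (hg : DifferentiableAt ℝ g (s, r)) :
    HasDerivAt (fun ρ : ℝ => g (s, ρ)) (fderiv ℝ g (s, r) (0, 1)) r :=
  hg.hasFDerivAt.comp_hasDerivAt r ((hasDerivAt_const r s).prodMk (hasDerivAt_id r))

/-! ### Space-like surfaces in local coordinates -/

section Surface

variable {M : Type*} [TopologicalSpace M] [ChartedSpace (EuclideanSpace ℝ (Fin 2)) M]

/-- `f` is a smooth local parametrization of the surface `M`: a diffeomorphism from an open
subset of the plane onto an open subset of `M`. -/
structure IsSmoothParam (f : OpenPartialHomeomorph (ℝ × ℝ) M) : Prop where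
  smooth : ContMDiffOn 𝓘(ℝ, ℝ × ℝ) (𝓡 2) ∞ f f.source
  smooth_symm : ContMDiffOn (𝓡 2) 𝓘(ℝ, ℝ × ℝ) ∞ f.symm f.target

theorem IsConicParametrization.isSmoothParam {x : M → E31} {f : OpenPartialHomeomorph (ℝ × ℝ) M}
    {a b c d : ℝ} {u : ℝ → ℝ} {φ : ℝ → E31} (h : IsConicParametrization x f a b c d u φ) :
    IsSmoothParam f := ⟨h.smooth, h.smooth_symm⟩

namespace IsSmoothParam

variable {f : OpenPartialHomeomorph (ℝ × ℝ) M} (hf : IsSmoothParam f)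
include hf

theorem mdifferentiable : f.MDifferentiable 𝓘(ℝ, ℝ × ℝ) (𝓡 2) :=
  ⟨hf.smooth.mdifferentiableOn (by simp), hf.smooth_symm.mdifferentiableOn (by simp)⟩

theorem contDiffOn {F : Type*} [NormedAddCommGroup F] [NormedSpace ℝ F] {x : M → F}
    (hx : ContMDiff (𝓡 2) 𝓘(ℝ, F) ∞ x) : ContDiffOn ℝ ∞ (fun q => x (f q)) f.source :=
  contMDiffOn_iff_contDiffOn.1 (hx.comp_contMDiffOn hf.smooth)

theorem differentiableAt {F : Type*} [NormedAddCommGroup F] [NormedSpace ℝ F] {x : M → F}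
    (hx : ContMDiff (𝓡 2) 𝓘(ℝ, F) ∞ x) {q : ℝ × ℝ} (hq : q ∈ f.source) :
    DifferentiableAt ℝ (fun q => x (f q)) q :=
  ((hf.contDiffOn hx).contDiffAt (f.open_source.mem_nhds hq)).differentiableAt (by simp)

theorem mfderiv_bijective {q : ℝ × ℝ} (hq : q ∈ f.source) :
    Function.Bijective (mfderiv 𝓘(ℝ, ℝ × ℝ) (𝓡 2) f q) :=
  hf.mdifferentiable.mfderiv_bijective hq

theorem exists_mfderiv_eq {q : ℝ × ℝ} (hq : q ∈ f.source) (v : TangentSpace (𝓡 2) (f q)) :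
    ∃ w : ℝ × ℝ, mfderiv 𝓘(ℝ, ℝ × ℝ) (𝓡 2) f q w = v :=
  (hf.mfderiv_bijective hq).2 v

theorem fderiv_comp {x : M → E31} (hx : ContMDiff (𝓡 2) 𝓘(ℝ, E31) ∞ x) {q : ℝ × ℝ}
    (hq : q ∈ f.source) (v : ℝ × ℝ) :
    fderiv ℝ (fun q => x (f q)) q v =
      differential x (f q) (mfderiv 𝓘(ℝ, ℝ × ℝ) (𝓡 2) f q v) := by
  have h := mfderiv_comp (I := 𝓘(ℝ, ℝ × ℝ)) (I' := 𝓡 2) (I'' := 𝓘(ℝ, E31)) q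
    (hx.mdifferentiableAt (x := f q) (by simp)) (hf.mdifferentiable.mdifferentiableAt hq)
  have h2 : fderiv ℝ (fun q => x (f q)) q = mfderiv 𝓘(ℝ, ℝ × ℝ) 𝓘(ℝ, E31) (x ∘ f) q :=
    mfderiv_eq_fderiv.symm
  rw [h2, h]
  rfl

end IsSmoothParam

theorem IsUnitNormal.neg {x N : M → E31} (hN : IsUnitNormal x N) :
    IsUnitNormal x (fun q => -N q) where
  smooth := hN.smooth.neg
  unit p := by rw [ip_neg_left, ip_neg_right, neg_neg, hN.unit p]
  normal p v := by rw [ip_neg_left, hN.normal p v, neg_zero]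

theorem IsSpacelikeImmersion.injective {x : M → E31} (hx : IsSpacelikeImmersion x) (p : M) :
    Function.Injective (differential x p) := by
  rw [injective_iff_map_eq_zero]
  intro v hv
  by_contra h
  have := hx.pos p v h
  rw [hv, ip_zero_left] at this
  exact lt_irrefl _ this

theorem IsSmoothParam.ip_fderiv_pos {x : M → E31} {f : OpenPartialHomeomorph (ℝ × ℝ) M}
    (hf : IsSmoothParam f) (hx : IsSpacelikeImmersion x) {q v : ℝ × ℝ} (hq : q ∈ f.source)
    (hv : v ≠ 0) :
    0 < ip (fderiv ℝ (fun q => x (f q)) q v) (fderiv ℝ (fun q => x (f q)) q v) := by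
  rw [hf.fderiv_comp hx.smooth hq]
  refine hx.pos _ _ fun h0 => hv ?_
  exact (hf.mfderiv_bijective hq).1 (h0.trans (map_zero _).symm)

/-- The tangent plane is the whole orthogonal complement of the normal, by a dimension count. -/
theorem IsUnitNormal.exists_differential_eq {x N : M → E31} (hx : IsSpacelikeImmersion x)
    (hN : IsUnitNormal x N) (p : M) {w : E31} (hw : ip (N p) w = 0) :
    ∃ v, differential x p v = w := by
  let ℓ : E31 →ₗ[ℝ] ℝ :=
    { toFun := ip (N p), map_add' := ip_add_right _, map_smul' := fun c v => ip_smul_right c _ v }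
  let A : EuclideanSpace ℝ (Fin 2) →ₗ[ℝ] E31 := (differential x p).toLinearMap
  have hle : LinearMap.range A ≤ LinearMap.ker ℓ := by
    rintro _ ⟨v, rfl⟩
    exact hN.normal p v
  have h1 : Module.finrank ℝ (LinearMap.range A) = 2 := by
    have hA : Function.Injective A := hx.injective p
    rw [LinearMap.finrank_range_of_inj hA]; simp
  have h2 := ℓ.finrank_range_add_finrank_ker
  have hsurj : LinearMap.range ℓ = ⊤ := by
    refine LinearMap.range_eq_top.2 (LinearMap.surjective ?_)
    intro h0
    have := LinearMap.congr_fun h0 (N p)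
    simp [ℓ, hN.unit p] at this
  rw [hsurj, finrank_top] at h2
  simp at h2
  have heq := Submodule.eq_of_le_of_finrank_eq hle (by omega)
  have hmem : w ∈ LinearMap.ker ℓ := hw
  rw [← heq] at hmem
  exact hmem

/-- The differential of the unit normal takes values in the tangent plane. -/
theorem IsUnitNormal.ip_differential {x N : M → E31} (hN : IsUnitNormal x N)
    {f : OpenPartialHomeomorph (ℝ × ℝ) M} (hf : IsSmoothParam f) {p : M} (hp : p ∈ f.target)
    (v : TangentSpace (𝓡 2) p) : ip (N p) (differential N p v) = 0 := by
  obtain ⟨q, hq, rfl⟩ : ∃ q ∈ f.source, f q = p := ⟨_, f.map_target hp, f.right_inv hp⟩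
  obtain ⟨w, rfl⟩ := hf.exists_mfderiv_eq hq v
  refine (congrArg (ip _) (hf.fderiv_comp hN.smooth hq w)).symm.trans ?_
  have h1 := hasDerivAt_line (hf.differentiableAt hN.smooth hq) w
  have h2 := (h1.ip h1).unique ((hasDerivAt_const (0 : ℝ) (-1 : ℝ)).congr_of_eventuallyEq
    (Filter.Eventually.of_forall fun τ => hN.unit _))
  have h3 : q + (0 : ℝ) • w = q := by rw [zero_smul, add_zero]
  simp only [h3] at h2
  rw [ip_comm] at h2
  linarith

/-- By injectivity of `dx`, a vector with `dN v = -k dx v` is a principal direction; the shape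
operator is `dx⁻¹ ∘ dN` up to sign. -/
theorem IsUnitNormal.isPrincipalDirection {x N : M → E31} (hx : IsSpacelikeImmersion x)
    (hN : IsUnitNormal x N) {f : OpenPartialHomeomorph (ℝ × ℝ) M} (hf : IsSmoothParam f) {p : M}
    (hp : p ∈ f.target) {v : TangentSpace (𝓡 2) p} (hv : v ≠ 0) {k : ℝ}
    (h : differential N p v = -(k • differential x p v)) : IsPrincipalDirection x N p v := by
  obtain ⟨g, hg⟩ := (differential x p).toLinearMap.exists_leftInverse_of_injective
    (LinearMap.ker_eq_bot.2 (hx.injective p))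
  have hg' : ∀ v, g (differential x p v) = v := fun v => LinearMap.congr_fun hg v
  refine ⟨-(g ∘ₗ (differential N p).toLinearMap), fun w => ?_, k, ?_⟩
  · obtain ⟨w', hw'⟩ := hN.exists_differential_eq hx p (hN.ip_differential hf hp w)
    change differential N p w = -differential x p (-(g (differential N p w)))
    rw [← hw', hg', map_neg, neg_neg]
  · rw [Module.End.hasEigenvector_iff, Module.End.mem_eigenspace_iff]
    refine ⟨?_, hv⟩
    change -(g (differential N p v)) = k • v
    rw [h, map_neg, map_smul, hg', neg_neg]

theorem IsPrincipalDirection.exists_eq {x N : M → E31} {p : M} {v : TangentSpace (𝓡 2) p}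
    (h : IsPrincipalDirection x N p v) :
    v ≠ 0 ∧ ∃ k : ℝ, differential N p v = -(k • differential x p v) := by
  obtain ⟨S, hS, k, hk⟩ := h
  refine ⟨hk.2, k, ?_⟩
  rw [hS v, hk.apply_eq_smul, map_smul]

theorem IsPrincipalDirection.smul {x N : M → E31} {p : M} {v : TangentSpace (𝓡 2) p}
    (h : IsPrincipalDirection x N p v) {c : ℝ} (hc : c ≠ 0) :
    IsPrincipalDirection x N p (c • v) := by
  obtain ⟨S, hS, k, hk⟩ := h
  refine ⟨S, hS, k, ?_⟩
  rw [Module.End.hasEigenvector_iff] at hk ⊢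
  exact ⟨Submodule.smul_mem _ c hk.1, smul_ne_zero hc hk.2⟩

theorem differential_neg (N : M → E31) (p : M) (v : TangentSpace (𝓡 2) p) :
    differential (fun q => -N q) p v = -differential N p v := by
  have h : mfderiv (𝓡 2) 𝓘(ℝ, E31) (fun q => -N q) p = -mfderiv (𝓡 2) 𝓘(ℝ, E31) N p :=
    mfderiv_neg
  exact congrArg (fun A => A v) h

theorem IsPrincipalDirection.of_neg {x N : M → E31} {p : M} {v : TangentSpace (𝓡 2) p}
    (h : IsPrincipalDirection x (fun q => -N q) p v) : IsPrincipalDirection x N p v := by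
  obtain ⟨S, hS, k, hk⟩ := h
  refine ⟨-S, fun w => ?_, -k, ?_⟩
  · have := hS w
    rw [differential_neg, neg_inj] at this
    rw [this, LinearMap.neg_apply, map_neg, neg_neg]
  · rw [Module.End.hasEigenvector_iff, Module.End.mem_eigenspace_iff] at hk ⊢
    exact ⟨by rw [LinearMap.neg_apply, hk.1, neg_smul], hk.2⟩

end Surface

/-! ### The moving frame of a conic parametrization -/

/-- The unit position vector `cosh u φ + sinh u φ ∧ φ'` of a conic parametrization. -/
def conicPosition (u : ℝ → ℝ) (φ : ℝ → E31) (s t : ℝ) : E31 :=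
  Real.cosh (u s) • φ t + Real.sinh (u s) • wedge (φ t) (deriv φ t)

/-- The unit time-like vector `sinh u φ + cosh u φ ∧ φ'`, which completes `conicPosition` to an
orthonormal basis of the plane spanned by the position vector and the normal. -/
def conicConormal (u : ℝ → ℝ) (φ : ℝ → E31) (s t : ℝ) : E31 :=
  Real.sinh (u s) • φ t + Real.cosh (u s) • wedge (φ t) (deriv φ t)

section Frame

variable {u : ℝ → ℝ} {φ : ℝ → E31} {s t : ℝ}

theorem hasDerivAt_conicPosition {u' : ℝ} (hu : HasDerivAt u u' s) :
    HasDerivAt (fun σ => conicPosition u φ σ t) (u' • conicConormal u φ s t) s := by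
  refine ((hu.cosh.smul_const (φ t)).add
    (hu.sinh.smul_const (wedge (φ t) (deriv φ t)))).congr_deriv ?_
  simp only [conicConormal, smul_add, smul_smul, mul_comm]

theorem hasDerivAt_conicConormal {u' : ℝ} (hu : HasDerivAt u u' s) :
    HasDerivAt (fun σ => conicConormal u φ σ t) (u' • conicPosition u φ s t) s := by
  refine ((hu.sinh.smul_const (φ t)).add
    (hu.cosh.smul_const (wedge (φ t) (deriv φ t)))).congr_deriv ?_
  simp only [conicPosition, smul_add, smul_smul, mul_comm]

variable (h1 : ip (φ t) (φ t) = 1) (h2 : ip (deriv φ t) (deriv φ t) = 1)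
  (h3 : ip (φ t) (deriv φ t) = 0)
include h1 h2 h3

theorem ip_wedge_deriv_self :
    ip (wedge (φ t) (deriv φ t)) (wedge (φ t) (deriv φ t)) = -1 := by
  rw [ip_wedge_wedge, h1, h2, h3, ip_comm, h3]; norm_num

theorem ip_conicPosition_self : ip (conicPosition u φ s t) (conicPosition u φ s t) = 1 := by
  have h4 := ip_wedge_left_self (φ t) (deriv φ t)
  have h5 := ip_wedge_deriv_self h1 h2 h3
  simp only [conicPosition, ip_add_left, ip_add_right, ip_smul_left, ip_smul_right, h1, h5, h4,
    ip_comm (φ t) (wedge (φ t) (deriv φ t))]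
  linear_combination Real.cosh_sq (u s)

theorem ip_conicConormal_self : ip (conicConormal u φ s t) (conicConormal u φ s t) = -1 := by
  have h4 := ip_wedge_left_self (φ t) (deriv φ t)
  have h5 := ip_wedge_deriv_self h1 h2 h3
  simp only [conicConormal, ip_add_left, ip_add_right, ip_smul_left, ip_smul_right, h1, h5, h4,
    ip_comm (φ t) (wedge (φ t) (deriv φ t))]
  linear_combination -Real.cosh_sq (u s)

theorem ip_conicPosition_conicConormal :
    ip (conicPosition u φ s t) (conicConormal u φ s t) = 0 := by
  have h4 := ip_wedge_left_self (φ t) (deriv φ t)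
  have h5 := ip_wedge_deriv_self h1 h2 h3
  simp only [conicPosition, conicConormal, ip_add_left, ip_add_right, ip_smul_left,
    ip_smul_right, h1, h5, h4, ip_comm (φ t) (wedge (φ t) (deriv φ t))]
  ring

omit h2 in
/-- Along `t` the unit position vector moves orthogonally to itself and to the conormal. -/
theorem exists_hasDerivAt_conicPosition_snd (hφ : HasDerivAt φ (deriv φ t) t)
    {φ'' : E31} (hφ' : HasDerivAt (deriv φ) φ'' t) (h6 : ip (deriv φ t) φ'' = 0) :
    ∃ W, HasDerivAt (fun τ => conicPosition u φ s τ) W t ∧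
      ip W (conicPosition u φ s t) = 0 ∧ ip W (conicConormal u φ s t) = 0 := by
  have h4 := ip_wedge_left_self (φ t) φ''
  have h5 := ip_wedge_right_self (φ t) (deriv φ t)
  have h7 : ip (wedge (φ t) φ'') (wedge (φ t) (deriv φ t)) = 0 := by
    rw [ip_wedge_wedge, h1, h3, ip_comm φ'', h6]; ring
  refine ⟨_, (hφ.const_smul (Real.cosh (u s))).fun_add
    ((hφ.wedge hφ').const_smul (Real.sinh (u s))), ?_, ?_⟩ <;>
  · simp only [conicPosition, conicConormal, wedge_self, zero_add, ip_add_left, ip_add_right,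
      ip_smul_left, ip_smul_right, h4, h7, ip_comm (deriv φ t) (wedge (φ t) (deriv φ t)), h5,
      ip_comm (deriv φ t) (φ t), h3]
    ring

end Frame

section Surface

variable {M : Type*} [TopologicalSpace M] [ChartedSpace (EuclideanSpace ℝ (Fin 2)) M]

namespace IsConicParametrization

variable {x : M → E31} {f : OpenPartialHomeomorph (ℝ × ℝ) M} {a b c d : ℝ} {u : ℝ → ℝ}
  {φ : ℝ → E31} (h : IsConicParametrization x f a b c d u φ)
include h

theorem mem_source {s t : ℝ} (hs : s ∈ Set.Ioo a b) (ht : t ∈ Set.Ioo c d) :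
    (s, t) ∈ f.source := by rw [h.source_eq]; exact ⟨hs, ht⟩

theorem hasDerivAt_u {s : ℝ} (hs : s ∈ Set.Ioo a b) : HasDerivAt u (deriv u s) s :=
  ((h.smooth_u.contDiffAt (isOpen_Ioo.mem_nhds hs)).differentiableAt (by simp)).hasDerivAt

theorem hasDerivAt_curve {t : ℝ} (ht : t ∈ Set.Ioo c d) : HasDerivAt φ (deriv φ t) t :=
  ((h.smooth_curve.contDiffAt (isOpen_Ioo.mem_nhds ht)).differentiableAt (by simp)).hasDerivAt

theorem contDiffOn_deriv_curve : ContDiffOn ℝ ∞ (deriv φ) (Set.Ioo c d) :=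
  ((contDiffOn_infty_iff_deriv_of_isOpen isOpen_Ioo).1 h.smooth_curve).2

theorem hasDerivAt_deriv_curve {t : ℝ} (ht : t ∈ Set.Ioo c d) :
    HasDerivAt (deriv φ) (deriv (deriv φ) t) t :=
  ((h.contDiffOn_deriv_curve.contDiffAt
    (isOpen_Ioo.mem_nhds ht)).differentiableAt (by simp)).hasDerivAt

theorem ip_curve_deriv {t : ℝ} (ht : t ∈ Set.Ioo c d) : ip (φ t) (deriv φ t) = 0 := by
  have h1 := h.hasDerivAt_curve ht
  have h2 := (h1.ip h1).unique ((hasDerivAt_const t (1 : ℝ)).congr_of_eventuallyEq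
    (Filter.eventually_of_mem (isOpen_Ioo.mem_nhds ht) fun τ hτ => h.deSitter τ hτ))
  rw [ip_comm (deriv φ t)] at h2
  linarith

theorem ip_deriv_deriv_curve {t : ℝ} (ht : t ∈ Set.Ioo c d) :
    ip (deriv φ t) (deriv (deriv φ) t) = 0 := by
  have h1 := h.hasDerivAt_deriv_curve ht
  have h2 := (h1.ip h1).unique ((hasDerivAt_const t (1 : ℝ)).congr_of_eventuallyEq
    (Filter.eventually_of_mem (isOpen_Ioo.mem_nhds ht) fun τ hτ => h.arclength τ hτ))
  rw [ip_comm (deriv (deriv φ) t)] at h2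
  linarith

/-- The two coordinate tangent vectors of a conic parametrization: the first is
`cosh u φ + sinh u φ ∧ φ' + s u' (sinh u φ + cosh u φ ∧ φ')`, the second is orthogonal to both
vectors occurring in it. -/
theorem fderiv_eq (hx : IsSpacelikeImmersion x) {s t : ℝ} (hs : s ∈ Set.Ioo a b)
    (ht : t ∈ Set.Ioo c d) :
    fderiv ℝ (fun q => x (f q)) (s, t) (1, 0) =
        conicPosition u φ s t + (s * deriv u s) • conicConormal u φ s t ∧
      ip (fderiv ℝ (fun q => x (f q)) (s, t) (0, 1)) (conicPosition u φ s t) = 0 ∧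
      ip (fderiv ℝ (fun q => x (f q)) (s, t) (0, 1)) (conicConormal u φ s t) = 0 := by
  have hd := h.isSmoothParam.differentiableAt hx.smooth (h.mem_source hs ht)
  constructor
  · have h1 := ((hasDerivAt_id s).smul (hasDerivAt_conicPosition (φ := φ) (t := t)
      (h.hasDerivAt_u hs))).congr_of_eventuallyEq
      (f₁ := fun σ => x (f (σ, t)))
      (Filter.eventually_of_mem (isOpen_Ioo.mem_nhds hs) fun σ hσ => h.eq σ hσ t ht)
    rw [(hasDerivAt_fst hd).unique h1]
    simp only [id, smul_smul, one_smul]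
    rw [add_comm]
  · obtain ⟨W, hW, hW1, hW2⟩ := exists_hasDerivAt_conicPosition_snd (u := u) (s := s)
      (h.deSitter t ht) (h.ip_curve_deriv ht) (h.hasDerivAt_curve ht)
      (h.hasDerivAt_deriv_curve ht) (h.ip_deriv_deriv_curve ht)
    have h1 := (hW.const_smul s).congr_of_eventuallyEq (f₁ := fun τ => x (f (s, τ)))
      (Filter.eventually_of_mem (isOpen_Ioo.mem_nhds ht) fun τ hτ => h.eq s hs τ hτ)
    rw [(hasDerivAt_snd hd).unique h1, ip_smul_left, ip_smul_left, hW1, hW2]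
    simp

/-- The surface is space-like, so `s u'` has absolute value less than one. -/
theorem sq_lt_one (hx : IsSpacelikeImmersion x) {s : ℝ} (hs : s ∈ Set.Ioo a b) :
    (s * deriv u s) ^ 2 < 1 := by
  obtain ⟨t, ht⟩ := Set.nonempty_Ioo.2 h.lt_right
  have h1 := h.isSmoothParam.ip_fderiv_pos hx (h.mem_source hs ht) (v := (1, 0)) (by simp)
  have e1 := h.deSitter t ht
  have e2 := h.arclength t ht
  have e3 := h.ip_curve_deriv ht
  rw [(h.fderiv_eq hx hs ht).1] at h1
  simp only [ip_add_left, ip_add_right, ip_smul_left, ip_smul_right,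
    ip_conicPosition_self e1 e2 e3, ip_conicConormal_self e1 e2 e3,
    ip_comm (conicConormal u φ s t) (conicPosition u φ s t),
    ip_conicPosition_conicConormal e1 e2 e3] at h1
  nlinarith

theorem contDiffOn_deriv_u : ContDiffOn ℝ ∞ (deriv u) (Set.Ioo a b) :=
  ((contDiffOn_infty_iff_deriv_of_isOpen isOpen_Ioo).1 h.smooth_u).2

/-- There is a smooth `θ` with `tanh θ = s u'`. -/
theorem exists_theta (hx : IsSpacelikeImmersion x) : ∃ θ : ℝ → ℝ,
    ContDiffOn ℝ ∞ θ (Set.Ioo a b) ∧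
    ∀ s ∈ Set.Ioo a b, Real.sinh (θ s) = s * deriv u s * Real.cosh (θ s) := by
  have hw : ContDiffOn ℝ ∞ (fun s => s * deriv u s) (Set.Ioo a b) :=
    contDiffOn_id.mul h.contDiffOn_deriv_u
  refine ⟨fun s => Real.arsinh (s * deriv u s / √(1 - (s * deriv u s) ^ 2)), ?_, ?_⟩
  · refine ContDiffOn.arsinh (hw.div ((contDiffOn_const.sub (hw.pow 2)).sqrt fun s hs => ?_)
      fun s hs => ?_)
    · have := h.sq_lt_one hx hs
      exact (sub_pos.2 this).ne'
    · have := h.sq_lt_one hx hs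
      exact (Real.sqrt_pos.2 (sub_pos.2 this)).ne'
  · intro s hs
    have h1 : 0 < 1 - (s * deriv u s) ^ 2 := sub_pos.2 (h.sq_lt_one hx hs)
    set w := s * deriv u s
    have h2 : Real.sqrt (1 + (w / √(1 - w ^ 2)) ^ 2) = 1 / √(1 - w ^ 2) := by
      rw [div_pow, Real.sq_sqrt h1.le, ← Real.sqrt_one, ← Real.sqrt_div (by simp), Real.sqrt_one]
      congr 1
      field_simp
      ring
    rw [Real.sinh_arsinh, Real.cosh_arsinh, h2]
    ring

/-- If the unit normal is `-(sinh θ y + cosh θ z)` in terms of the moving frame, then the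
decomposition of the position vector holds, with `e₁` the normalized first coordinate vector:
`dN` maps it to a multiple of itself because `y` and `z` rotate hyperbolically in the plane they
span. -/
theorem hasDecomposition {N : M → E31} (hx : IsSpacelikeImmersion x) (hN : IsUnitNormal x N)
    {θ : ℝ → ℝ} (hθ : ContDiffOn ℝ ∞ θ (Set.Ioo a b))
    (hθu : ∀ s ∈ Set.Ioo a b, Real.sinh (θ s) = s * deriv u s * Real.cosh (θ s))
    (hn : ∀ s ∈ Set.Ioo a b, ∀ t ∈ Set.Ioo c d, N (f (s, t)) =
      -(Real.sinh (θ s) • conicPosition u φ s t + Real.cosh (θ s) • conicConormal u φ s t)) :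
    HasDecomposition x N f a b c d u := by
  refine ⟨θ, hθ, fun s hs => ?_, fun s hs t ht => ?_⟩
  · rw [Real.tanh_eq_sinh_div_cosh, hθu s hs, mul_div_cancel_right₀ _ (Real.cosh_pos _).ne']
  have hf := h.isSmoothParam
  have hq := h.mem_source hs ht
  have e1 := h.deSitter t ht
  have e2 := h.arclength t ht
  have e3 := h.ip_curve_deriv ht
  have hXs := (h.fderiv_eq hx hs ht).1
  have hNs : fderiv ℝ (fun q => N (f q)) (s, t) (1, 0) =
      -((deriv θ s + deriv u s) • (Real.cosh (θ s) • conicPosition u φ s t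
        + Real.sinh (θ s) • conicConormal u φ s t)) := by
    have hθ' : HasDerivAt θ (deriv θ s) s :=
      ((hθ.contDiffAt (isOpen_Ioo.mem_nhds hs)).differentiableAt (by simp)).hasDerivAt
    have h1 := ((hθ'.sinh.smul (hasDerivAt_conicPosition (φ := φ) (t := t)
      (h.hasDerivAt_u hs))).add (hθ'.cosh.smul (hasDerivAt_conicConormal (φ := φ) (t := t)
      (h.hasDerivAt_u hs)))).neg.congr_of_eventuallyEq (f₁ := fun σ => N (f (σ, t)))
      (Filter.eventually_of_mem (isOpen_Ioo.mem_nhds hs) fun σ hσ => hn σ hσ t ht)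
    rw [(hasDerivAt_fst (hf.differentiableAt hN.smooth hq)).unique h1]
    module
  have hc := Real.cosh_sq (θ s)
  have hsu := hθu s hs
  -- `cosh θ` normalizes the first coordinate vector
  have hvec : Real.cosh (θ s) • fderiv ℝ (fun q => x (f q)) (s, t) (1, 0) =
      Real.cosh (θ s) • conicPosition u φ s t + Real.sinh (θ s) • conicConormal u φ s t := by
    rw [hXs, hsu]; module
  have hdx : differential x (f (s, t))
      (Real.cosh (θ s) • mfderiv 𝓘(ℝ, ℝ × ℝ) (𝓡 2) f (s, t) (1, 0)) =
      Real.cosh (θ s) • conicPosition u φ s t + Real.sinh (θ s) • conicConormal u φ s t := by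
    rw [map_smul, ← hvec, hf.fderiv_comp hx.smooth hq]
  have hdN : differential N (f (s, t))
      (Real.cosh (θ s) • mfderiv 𝓘(ℝ, ℝ × ℝ) (𝓡 2) f (s, t) (1, 0)) =
      -((Real.cosh (θ s) * (deriv θ s + deriv u s)) •
        (Real.cosh (θ s) • conicPosition u φ s t + Real.sinh (θ s) • conicConormal u φ s t)) := by
    have := hf.fderiv_comp hN.smooth hq (1, 0)
    rw [map_smul, mul_smul, ← smul_neg, ← hNs, this]
  have hunit : ip (Real.cosh (θ s) • conicPosition u φ s t
        + Real.sinh (θ s) • conicConormal u φ s t)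
      (Real.cosh (θ s) • conicPosition u φ s t
        + Real.sinh (θ s) • conicConormal u φ s t) = 1 := by
    simp only [ip_add_left, ip_add_right, ip_smul_left, ip_smul_right,
      ip_conicPosition_self e1 e2 e3, ip_conicConormal_self e1 e2 e3,
      ip_comm (conicConormal u φ s t) (conicPosition u φ s t),
      ip_conicPosition_conicConormal e1 e2 e3]
    linear_combination hc
  refine ⟨Real.cosh (θ s) • mfderiv 𝓘(ℝ, ℝ × ℝ) (𝓡 2) f (s, t) (1, 0), ?_, ?_, ?_⟩
  · rw [hdx, hunit]
  · refine hN.isPrincipalDirection (k := Real.cosh (θ s) * (deriv θ s + deriv u s)) hx hf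
      (f.map_source hq) ?_ (hdN.trans ?_)
    · intro h0
      rw [h0, map_zero] at hdx
      rw [← hdx, ip_zero_left] at hunit
      exact zero_ne_one hunit
    · rw [hdx]
  · rw [hdx, hn s hs t ht, h.eq s hs t ht]
    change s • conicPosition u φ s t = _
    -- the frames `y, z` and `e₁, n` are related by a hyperbolic rotation, here inverted
    congr 1
    calc conicPosition u φ s t = (Real.cosh (θ s) ^ 2 - Real.sinh (θ s) ^ 2) •
          conicPosition u φ s t := by rw [hc]; simp
      _ = _ := by module

/-- The image of a rectangle is connected, so the unit normal is globally one of the two unit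
normals computed from the moving frame. -/
theorem hasDecomposition_or {N : M → E31} (hx : IsSpacelikeImmersion x) (hN : IsUnitNormal x N) :
    HasDecomposition x N f a b c d u ∨ HasDecomposition x (fun q => -N q) f a b c d u := by
  obtain ⟨θ, hθ, hθu⟩ := h.exists_theta hx
  have hf := h.isSmoothParam
  let n : ℝ × ℝ → E31 := fun q => Real.sinh (θ q.1) • conicPosition u φ q.1 q.2
    + Real.cosh (θ q.1) • conicConormal u φ q.1 q.2
  have key : ∀ s ∈ Set.Ioo a b, ∀ t ∈ Set.Ioo c d,
      ip (N (f (s, t))) (n (s, t)) ^ 2 = 1 ∧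
        N (f (s, t)) = -ip (N (f (s, t))) (n (s, t)) • n (s, t) := by
    intro s hs t ht
    have hq := h.mem_source hs ht
    have e1 := h.deSitter t ht
    have e2 := h.arclength t ht
    have e3 := h.ip_curve_deriv ht
    obtain ⟨hXs, hXt1, hXt2⟩ := h.fderiv_eq hx hs ht
    have p1 := h.isSmoothParam.ip_fderiv_pos hx hq (v := (1, 0)) (by simp)
    have p2 := h.isSmoothParam.ip_fderiv_pos hx hq (v := (0, 1)) (by simp)
    have hsu := hθu s hs
    refine unit_normal_unique (a := fderiv ℝ (fun q => x (f q)) (s, t) (1, 0))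
      (b := fderiv ℝ (fun q => x (f q)) (s, t) (0, 1)) ?_ (hN.unit _) ?_ ?_ ?_ ?_ ?_
    · have : ip (fderiv ℝ (fun q => x (f q)) (s, t) (1, 0))
          (fderiv ℝ (fun q => x (f q)) (s, t) (0, 1)) = 0 := by
        rw [hXs, ip_comm, ip_add_right, ip_smul_right, hXt1, hXt2]; simp
      rw [this, mul_zero, sub_zero]
      exact mul_pos p1 p2
    · rw [hf.fderiv_comp hx.smooth hq]; exact hN.normal _ _
    · rw [hf.fderiv_comp hx.smooth hq]; exact hN.normal _ _
    · simp only [n, ip_add_left, ip_add_right, ip_smul_left, ip_smul_right,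
        ip_conicPosition_self e1 e2 e3, ip_conicConormal_self e1 e2 e3,
        ip_comm (conicConormal u φ s t) (conicPosition u φ s t),
        ip_conicPosition_conicConormal e1 e2 e3]
      linear_combination -Real.cosh_sq (θ s)
    · rw [hXs]
      simp only [n, ip_add_left, ip_add_right, ip_smul_left, ip_smul_right,
        ip_conicPosition_self e1 e2 e3, ip_conicConormal_self e1 e2 e3,
        ip_comm (conicConormal u φ s t) (conicPosition u φ s t),
        ip_conicPosition_conicConormal e1 e2 e3]
      linear_combination hsu
    · rw [ip_comm]
      simp only [n, ip_add_right, ip_smul_right, hXt1, hXt2]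
      ring
  have hcont : ContinuousOn (fun q => ip (N (f q)) (n q)) f.source := by
    have hfst : Set.MapsTo (Prod.fst : ℝ × ℝ → ℝ) f.source (Set.Ioo a b) := fun q hq => by
      rw [h.source_eq] at hq; exact hq.1
    have hsnd : Set.MapsTo (Prod.snd : ℝ × ℝ → ℝ) f.source (Set.Ioo c d) := fun q hq => by
      rw [h.source_eq] at hq; exact hq.2
    have c1 : ContDiffOn ℝ ∞ (fun q : ℝ × ℝ => θ q.1) f.source := hθ.comp contDiffOn_fst hfst
    have c2 : ContDiffOn ℝ ∞ (fun q : ℝ × ℝ => u q.1) f.source :=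
      h.smooth_u.comp contDiffOn_fst hfst
    have c3 : ContDiffOn ℝ ∞ (fun q : ℝ × ℝ => φ q.2) f.source :=
      h.smooth_curve.comp contDiffOn_snd hsnd
    have c4 : ContDiffOn ℝ ∞ (fun q : ℝ × ℝ => deriv φ q.2) f.source :=
      h.contDiffOn_deriv_curve.comp contDiffOn_snd hsnd
    have c5 := c3.wedge c4
    exact ((hf.contDiffOn hN.smooth).ip ((c1.sinh.smul ((c2.cosh.smul c3).add
      (c2.sinh.smul c5))).add (c1.cosh.smul ((c2.sinh.smul c3).add
      (c2.cosh.smul c5))))).continuousOn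
  have hconn : IsPreconnected f.source := by
    rw [h.source_eq]; exact isPreconnected_Ioo.prod isPreconnected_Ioo
  rcases hconn.eq_one_or_eq_neg_one_of_sq_eq hcont (fun q hq => by
    rw [h.source_eq] at hq
    exact (key q.1 hq.1 q.2 hq.2).1) with h1 | h1
  · refine Or.inl (h.hasDecomposition hx hN hθ hθu fun s hs t ht => ?_)
    have h2 := h1 (h.mem_source hs ht)
    have h3 := (key s hs t ht).2
    simp only [Pi.one_apply] at h2
    rw [h2] at h3
    rw [h3, neg_smul, one_smul]
  · refine Or.inr (h.hasDecomposition hx hN.neg hθ hθu fun s hs t ht => ?_)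
    have h2 := h1 (h.mem_source hs ht)
    have h3 := (key s hs t ht).2
    simp only [Pi.neg_apply, Pi.one_apply] at h2
    rw [h2] at h3
    rw [h3, neg_neg, one_smul]

end IsConicParametrization

/-- The tangential part of the position vector is a multiple of `e₁`. -/
theorem HasDecomposition.exists_tangentialPart {x N : M → E31} (hN : IsUnitNormal x N)
    (hcone : ∀ p : M, 0 < ip (x p) (x p)) {f : OpenPartialHomeomorph (ℝ × ℝ) M}
    {a b c d : ℝ} {u : ℝ → ℝ} (h : HasDecomposition x N f a b c d u) {s t : ℝ}
    (hs : s ∈ Set.Ioo a b) (ht : t ∈ Set.Ioo c d) :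
    ∃ v : TangentSpace (𝓡 2) (f (s, t)), differential x (f (s, t)) v =
      tangentialPart x N (f (s, t)) ∧ IsPrincipalDirection x N (f (s, t)) v := by
  obtain ⟨θ, -, -, h⟩ := h
  obtain ⟨v, -, hv2, hv3⟩ := h s hs t ht
  have hs0 : s ≠ 0 := by
    rintro rfl
    have := hcone (f (0, t))
    rw [hv3, zero_smul, ip_zero_left] at this
    exact lt_irrefl _ this
  refine ⟨(s * Real.cosh (θ s)) • v, ?_, hv2.smul (mul_ne_zero hs0 (Real.cosh_pos _).ne')⟩
  have h1 : ip (x (f (s, t))) (N (f (s, t))) = -(s * Real.sinh (θ s)) := by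
    rw [hv3, ip_smul_left, ip_add_left, ip_smul_left, ip_smul_left, hN.unit,
      ip_comm (differential x (f (s, t)) v), hN.normal]
    ring
  rw [tangentialPart, h1, map_smul]
  rw [hv3]
  module

/-- A surface covered by conic parametrizations is a GCR surface. -/
theorem isGCR_of_conic {x N : M → E31} (hx : IsSpacelikeImmersion x) (hN : IsUnitNormal x N)
    (hcone : ∀ p : M, 0 < ip (x p) (x p))
    (h : ∀ p : M, ∃ (f : OpenPartialHomeomorph (ℝ × ℝ) M) (a b c d : ℝ) (u : ℝ → ℝ)
      (φ : ℝ → E31), p ∈ f.target ∧ IsConicParametrization x f a b c d u φ) : IsGCR x N := by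
  intro p
  obtain ⟨f, a, b, c, d, u, φ, hp, hc⟩ := h p
  obtain ⟨⟨s, t⟩, hq, rfl⟩ : ∃ q ∈ f.source, f q = p := ⟨_, f.map_target hp, f.right_inv hp⟩
  rw [hc.source_eq] at hq
  rcases hc.hasDecomposition_or hx hN with h1 | h1
  · exact h1.exists_tangentialPart hN hcone hq.1 hq.2
  · obtain ⟨v, hv1, hv2⟩ := h1.exists_tangentialPart hN.neg hcone hq.1 hq.2
    refine ⟨v, hv1.trans ?_, hv2.of_neg⟩
    rw [tangentialPart, tangentialPart, ip_neg_right, smul_neg, neg_smul, neg_neg]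

end Surface

/-! ### Changing coordinates by the inverse function theorem -/

theorem exists_isSmoothParam {M : Type*} [TopologicalSpace M]
    [ChartedSpace (EuclideanSpace ℝ (Fin 2)) M] [IsManifold (𝓡 2) ∞ M] (p : M) :
    ∃ f : OpenPartialHomeomorph (ℝ × ℝ) M, IsSmoothParam f ∧ p ∈ f.target := by
  let A : (ℝ × ℝ) ≃L[ℝ] EuclideanSpace ℝ (Fin 2) :=
    ContinuousLinearEquiv.ofFinrankEq (by simp)
  let χ := chartAt (EuclideanSpace ℝ (Fin 2)) p
  have hA : ContMDiff 𝓘(ℝ, ℝ × ℝ) (𝓡 2) ∞ A := A.contDiff.contMDiff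
  have hA' : ContMDiff (𝓡 2) 𝓘(ℝ, ℝ × ℝ) ∞ A.symm := A.symm.contDiff.contMDiff
  refine ⟨A.toHomeomorph.toOpenPartialHomeomorph.trans χ.symm, ⟨?_, ?_⟩, ?_⟩
  · exact (contMDiffOn_chart_symm (I := 𝓡 2) (x := p) (n := ∞)).comp hA.contMDiffOn
      fun q hq => hq.2
  · exact hA'.comp_contMDiffOn ((contMDiffOn_chart (I := 𝓡 2) (x := p) (n := ∞)).mono
      fun q hq => hq.1)
  · simp [χ]

/-- If the derivative of `H` is injective at `q₀`, then `H` gives new coordinates near `f q₀`,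
defined on a rectangle. The map `ρ` expresses the old coordinates in terms of the new ones. -/
theorem IsSmoothParam.exists_reparam {M : Type*} [TopologicalSpace M]
    [ChartedSpace (EuclideanSpace ℝ (Fin 2)) M] {f : OpenPartialHomeomorph (ℝ × ℝ) M}
    (hf : IsSmoothParam f) {H : ℝ × ℝ → ℝ × ℝ} (hH : ContDiffOn ℝ ∞ H f.source) {q₀ : ℝ × ℝ}
    (hq₀ : q₀ ∈ f.source) (hinj : ∀ v, fderiv ℝ H q₀ v = 0 → v = 0) {W : Set (ℝ × ℝ)}
    (hW : W ∈ nhds q₀) :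
    ∃ (e : OpenPartialHomeomorph (ℝ × ℝ) M) (a b c d : ℝ) (ρ : ℝ × ℝ → ℝ × ℝ),
      IsSmoothParam e ∧ e.source = Set.Ioo a b ×ˢ Set.Ioo c d ∧ H q₀ ∈ e.source ∧
      e (H q₀) = f q₀ ∧ ContDiffOn ℝ ∞ ρ e.source ∧
      ∀ q ∈ e.source, ρ q ∈ f.source ∧ ρ q ∈ W ∧ e q = f (ρ q) ∧ H (ρ q) = q := by
  have hHq : ∀ q ∈ f.source, ContDiffAt ℝ ∞ H q := fun q hq =>
    hH.contDiffAt (f.open_source.mem_nhds hq)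
  let A : (ℝ × ℝ) ≃L[ℝ] (ℝ × ℝ) := (LinearEquiv.ofInjectiveEndo (fderiv ℝ H q₀).toLinearMap
    ((injective_iff_map_eq_zero _).2 hinj)).toContinuousLinearEquiv
  have hA : fderiv ℝ H q₀ = A := by ext <;> rfl
  have hd : HasFDerivAt H (A : (ℝ × ℝ) →L[ℝ] (ℝ × ℝ)) q₀ := by
    rw [← hA]; exact ((hHq q₀ hq₀).differentiableAt (by simp)).hasFDerivAt
  let e₀ := (hHq q₀ hq₀).toOpenPartialHomeomorph H hd (by simp)
  -- smoothness of the inverse needs an invertible derivative at all nearby points, not only at `q₀`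
  have hev : ∀ᶠ q in nhds q₀, q ∈ f.source ∧ q ∈ W ∧
      fderiv ℝ H q ∈ Set.range ((↑) : ((ℝ × ℝ) ≃L[ℝ] (ℝ × ℝ)) → (ℝ × ℝ) →L[ℝ] (ℝ × ℝ)) := by
    refine (f.open_source.eventually_mem hq₀).and (Filter.Eventually.and hW ?_)
    refine ((hHq q₀ hq₀).fderiv_right (m := ∞) (by simp)).continuousAt.eventually ?_
    rw [hA]
    exact ContinuousLinearEquiv.nhds A
  obtain ⟨V, hV, hVo, hqV⟩ := eventually_nhds_iff.1 hev
  let e₁ := e₀.restrOpen V hVo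
  have hq₁ : q₀ ∈ e₁.source := ⟨(hHq q₀ hq₀).mem_toOpenPartialHomeomorph_source hd (by simp), hqV⟩
  have ht₁ : H q₀ ∈ e₁.target := e₁.map_source hq₁
  have hs₁ : ∀ q ∈ e₁.target, e₁.symm q ∈ V := fun q hq => (e₁.map_target hq).2
  obtain ⟨a, b, c, d, hB, hBt⟩ : ∃ a b c d : ℝ, H q₀ ∈ Set.Ioo a b ×ˢ Set.Ioo c d ∧
      Set.Ioo a b ×ˢ Set.Ioo c d ⊆ e₁.target := by
    obtain ⟨ε, hε, hball⟩ := Metric.isOpen_iff.1 e₁.open_target _ ht₁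
    refine ⟨(H q₀).1 - ε, (H q₀).1 + ε, (H q₀).2 - ε, (H q₀).2 + ε,
      ⟨⟨by linarith, by linarith⟩, ⟨by linarith, by linarith⟩⟩, ?_⟩
    rw [← Real.ball_eq_Ioo, ← Real.ball_eq_Ioo, ball_prod_same]
    exact hball
  have hBo : IsOpen (Set.Ioo a b ×ˢ Set.Ioo c d) := isOpen_Ioo.prod isOpen_Ioo
  let e := (e₁.symm.trans f).restrOpen _ hBo
  have hes : e.source = Set.Ioo a b ×ˢ Set.Ioo c d := by
    change (e₁.target ∩ e₁.symm ⁻¹' f.source) ∩ _ = _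
    exact Set.inter_eq_right.2 fun q hq => ⟨hBt hq, (hV _ (hs₁ q (hBt hq))).1⟩
  have hρ : ContDiffOn ℝ ∞ e₁.symm e.source := by
    intro q hq
    rw [hes] at hq
    have hqt := hBt hq
    obtain ⟨h1, -, A', hA'⟩ := hV _ (hs₁ q hqt)
    refine (e₁.contDiffAt_symm hqt (f₀' := A') ?_ (hHq _ h1)).contDiffWithinAt
    rw [hA']
    exact ((hHq _ h1).differentiableAt (by simp)).hasFDerivAt
  refine ⟨e, a, b, c, d, e₁.symm, ⟨?_, ?_⟩, hes, hes ▸ hB, ?_, hρ, ?_⟩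
  · refine hf.smooth.comp hρ.contMDiffOn fun q hq => ?_
    rw [hes] at hq
    exact (hV _ (hs₁ q (hBt hq))).1
  · have h1 : ∀ p ∈ e.target, p ∈ f.target := fun p hp => hp.1.1
    exact hH.contMDiffOn.comp (hf.smooth_symm.mono h1) fun p hp => f.map_target (h1 p hp)
  · exact congrArg f (e₁.left_inv hq₁)
  · intro q hq
    rw [hes] at hq
    have h1 := hV _ (hs₁ q (hBt hq))
    exact ⟨h1.1, h1.2.1, rfl, e₁.right_inv (hBt hq)⟩

/-! ### The binormal field -/

/-- For a space-like vector `X` and a unit time-like vector `n`, the unit space-like vector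
orthogonal to both: the normalization of `n ∧ X`. On a surface with position vector `X` and unit
normal `n` it is the unit tangent vector orthogonal to the tangential part of `X`. -/
def binormal (X n : E31) : E31 := (√(ip X X + ip X n ^ 2))⁻¹ • wedge n X

section Binormal

variable {X n : E31}

theorem ip_binormal_left (X n : E31) : ip (binormal X n) X = 0 := by
  rw [binormal, ip_smul_left, ip_wedge_right_self, mul_zero]

theorem ip_binormal_right (X n : E31) : ip (binormal X n) n = 0 := by
  rw [binormal, ip_smul_left, ip_wedge_left_self, mul_zero]

theorem ip_wedge_normal_self (hn : ip n n = -1) :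
    ip (wedge n X) (wedge n X) = ip X X + ip X n ^ 2 := by
  rw [ip_wedge_wedge, hn, ip_comm n X]; ring

variable (hX : 0 < ip X X) (hn : ip n n = -1)
include hX hn

theorem ip_binormal_self : ip (binormal X n) (binormal X n) = 1 := by
  have h : 0 < ip X X + ip X n ^ 2 := by positivity
  rw [binormal, ip_smul_left, ip_smul_right, ip_wedge_normal_self hn, ← mul_assoc, ← mul_inv,
    Real.mul_self_sqrt h.le, inv_mul_cancel₀ h.ne']

theorem eq_smul_binormal {v : E31} (h1 : ip v X = 0) (h2 : ip v n = 0) :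
    v = ip (binormal X n) v • binormal X n := by
  have h : 0 < ip X X + ip X n ^ 2 := by positivity
  have h3 := eq_smul_wedge h2 h1 (by rw [ip_wedge_normal_self hn]; exact h.ne')
  rw [ip_wedge_normal_self hn] at h3
  rw [binormal, ip_smul_left, smul_smul, mul_right_comm, ← mul_inv, Real.mul_self_sqrt h.le,
    ← div_eq_inv_mul, ← h3]

theorem wedge_wedge_binormal : wedge (wedge X (binormal X n)) (binormal X n) = X := by
  rw [wedge_anticomm, wedge_wedge, ip_binormal_left, ip_binormal_self hX hn]
  simp

end Binormal

theorem _root_.ContDiffOn.binormal {E : Type*} [NormedAddCommGroup E] [NormedSpace ℝ E]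
    {s : Set E} {X n : E → E31} (hX : ContDiffOn ℝ ∞ X s) (hn : ContDiffOn ℝ ∞ n s)
    (h : ∀ q ∈ s, 0 < ip (X q) (X q)) : ContDiffOn ℝ ∞ (fun q => binormal (X q) (n q)) s := by
  have h1 : ∀ q ∈ s, 0 < ip (X q) (X q) + ip (X q) (n q) ^ 2 := fun q hq => by
    have := h q hq
    positivity
  exact ((((hX.ip hX).add ((hX.ip hn).pow 2)).sqrt fun q hq => (h1 q hq).ne').inv
    fun q hq => (Real.sqrt_pos.2 (h1 q hq)).ne').smul (hn.wedge hX)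

section Surface

variable {M : Type*} [TopologicalSpace M] [ChartedSpace (EuclideanSpace ℝ (Fin 2)) M]
  {x N : M → E31} {f : OpenPartialHomeomorph (ℝ × ℝ) M}

namespace IsSmoothParam

theorem ip_fderiv_normal (hf : IsSmoothParam f) (hx : IsSpacelikeImmersion x)
    (hN : IsUnitNormal x N) {q : ℝ × ℝ} (hq : q ∈ f.source) (v : ℝ × ℝ) :
    ip (N (f q)) (fderiv ℝ (fun q => x (f q)) q v) = 0 := by
  rw [hf.fderiv_comp hx.smooth hq]; exact hN.normal _ _

theorem ip_normal_fderiv_normal (hf : IsSmoothParam f) (hN : IsUnitNormal x N) {q : ℝ × ℝ}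
    (hq : q ∈ f.source) (v : ℝ × ℝ) :
    ip (N (f q)) (fderiv ℝ (fun q => N (f q)) q v) = 0 := by
  rw [hf.fderiv_comp hN.smooth hq]; exact hN.ip_differential hf (f.map_source hq) _

theorem contDiffOn_binormal (hf : IsSmoothParam f) (hx : IsSpacelikeImmersion x)
    (hN : IsUnitNormal x N) (hcone : ∀ p : M, 0 < ip (x p) (x p)) :
    ContDiffOn ℝ ∞ (fun q => binormal (x (f q)) (N (f q))) f.source :=
  (hf.contDiffOn hx.smooth).binormal (hf.contDiffOn hN.smooth) fun _ _ => hcone _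

theorem differentiableAt_binormal (hf : IsSmoothParam f) (hx : IsSpacelikeImmersion x)
    (hN : IsUnitNormal x N) (hcone : ∀ p : M, 0 < ip (x p) (x p)) {q : ℝ × ℝ}
    (hq : q ∈ f.source) : DifferentiableAt ℝ (fun q => binormal (x (f q)) (N (f q))) q :=
  ((hf.contDiffOn_binormal hx hN hcone).contDiffAt (f.open_source.mem_nhds hq)).differentiableAt
    (by simp)

/-- Self-adjointness of the shape operator, from the symmetry of second derivatives. -/
theorem ip_fderiv_comm (hf : IsSmoothParam f) (hx : IsSpacelikeImmersion x)
    (hN : IsUnitNormal x N) {q : ℝ × ℝ} (hq : q ∈ f.source) (v w : ℝ × ℝ) :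
    ip (fderiv ℝ (fun q => N (f q)) q v) (fderiv ℝ (fun q => x (f q)) q w) =
      ip (fderiv ℝ (fun q => N (f q)) q w) (fderiv ℝ (fun q => x (f q)) q v) := by
  have hX := (hf.contDiffOn hx.smooth).contDiffAt (f.open_source.mem_nhds hq)
  have hD : DifferentiableAt ℝ (fderiv ℝ (fun q => x (f q))) q :=
    (hX.fderiv_right (m := ∞) (by simp)).differentiableAt (by simp)
  have key : ∀ v w : ℝ × ℝ,
      ip (fderiv ℝ (fun q => N (f q)) q v) (fderiv ℝ (fun q => x (f q)) q w) =
        -ip (N (f q)) (fderiv ℝ (fderiv ℝ (fun q => x (f q))) q v w) := by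
    intro v w
    have h1 := hasDerivAt_line (hf.differentiableAt hN.smooth hq) v
    have h2 := (hasDerivAt_line hD v).clm_apply (hasDerivAt_const (0 : ℝ) w)
    have hmem : ∀ᶠ τ : ℝ in nhds 0, q + τ • v ∈ f.source := by
      have hc : ContinuousAt (fun τ : ℝ => q + τ • v) 0 := by fun_prop
      exact hc.eventually (f.open_source.eventually_mem (by simpa using hq))
    have h3 := (h1.ip h2).unique ((hasDerivAt_const (0 : ℝ) (0 : ℝ)).congr_of_eventuallyEq
      (hmem.mono fun τ hτ => hf.ip_fderiv_normal hx hN hτ w))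
    simp only [zero_smul, add_zero, map_zero] at h3
    linarith
  have hsymm := hX.isSymmSndFDerivAt (by
    rw [minSmoothness_of_isRCLikeNormedField]; exact ENat.LEInfty.out) v w
  rw [key v w, key w v, hsymm]

theorem exists_fderiv_eq_of_isGCR (hf : IsSmoothParam f) (hx : IsSpacelikeImmersion x)
    (hN : IsUnitNormal x N) (hG : IsGCR x N) {q : ℝ × ℝ} (hq : q ∈ f.source) :
    ∃ v : ℝ × ℝ, ∃ k : ℝ, v ≠ 0 ∧
      fderiv ℝ (fun q => x (f q)) q v = x (f q) + ip (x (f q)) (N (f q)) • N (f q) ∧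
      fderiv ℝ (fun q => N (f q)) q v = -(k • fderiv ℝ (fun q => x (f q)) q v) := by
  obtain ⟨v', hv1, hv2⟩ := hG (f q)
  obtain ⟨h0, k, hk⟩ := hv2.exists_eq
  obtain ⟨v, rfl⟩ := hf.exists_mfderiv_eq hq v'
  refine ⟨v, k, ?_, ?_, ?_⟩
  · rintro rfl
    exact h0 (map_zero _)
  · rw [hf.fderiv_comp hx.smooth hq]; exact hv1
  · rw [hf.fderiv_comp hN.smooth hq, hf.fderiv_comp hx.smooth hq]; exact hk

/-- The binormal field is constant in the direction of the tangential part of the position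
vector if that is a principal direction: its derivative is orthogonal to the position vector,
to the normal and to the binormal itself. -/
theorem fderiv_binormal_eq_zero (hf : IsSmoothParam f) (hx : IsSpacelikeImmersion x)
    (hN : IsUnitNormal x N) (hcone : ∀ p : M, 0 < ip (x p) (x p)) {q v : ℝ × ℝ} {k : ℝ}
    (hq : q ∈ f.source)
    (hv : fderiv ℝ (fun q => x (f q)) q v = x (f q) + ip (x (f q)) (N (f q)) • N (f q))
    (hk : fderiv ℝ (fun q => N (f q)) q v = -(k • fderiv ℝ (fun q => x (f q)) q v)) :
    fderiv ℝ (fun q => binormal (x (f q)) (N (f q))) q v = 0 := by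
  have hβ := hasDerivAt_line (hf.differentiableAt_binormal hx hN hcone hq) v
  have hX := hasDerivAt_line (hf.differentiableAt hx.smooth hq) v
  have hn := hasDerivAt_line (hf.differentiableAt hN.smooth hq) v
  have h0 : q + (0 : ℝ) • v = q := by simp
  have h1 := (hβ.ip hX).unique ((hasDerivAt_const (0 : ℝ) (0 : ℝ)).congr_of_eventuallyEq
    (Filter.Eventually.of_forall fun τ => ip_binormal_left _ _))
  have h2 := (hβ.ip hn).unique ((hasDerivAt_const (0 : ℝ) (0 : ℝ)).congr_of_eventuallyEq
    (Filter.Eventually.of_forall fun τ => ip_binormal_right _ _))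
  have h3 := (hβ.ip hβ).unique ((hasDerivAt_const (0 : ℝ) (1 : ℝ)).congr_of_eventuallyEq
    (Filter.Eventually.of_forall fun τ => ip_binormal_self (hcone _) (hN.unit _)))
  simp only [h0, hk, hv, ip_neg_right, ip_smul_right, ip_add_right, ip_binormal_left,
    ip_binormal_right, mul_zero, add_zero, neg_zero] at h1 h2
  simp only [h0] at h3
  rw [eq_smul_binormal (hcone (f q)) (hN.unit (f q)) h1 h2]
  rw [ip_comm] at h3
  have h4 : ip (binormal (x (f q)) (N (f q)))
      (fderiv ℝ (fun q => binormal (x (f q)) (N (f q))) q v) = 0 := by linarith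
  rw [h4, zero_smul]

/-- Differentiated form of `⟨e, x⟩ = 0` for the binormal `e`. -/
theorem ip_binormal_fderiv (hf : IsSmoothParam f) (hx : IsSpacelikeImmersion x)
    (hN : IsUnitNormal x N) (hcone : ∀ p : M, 0 < ip (x p) (x p)) {q : ℝ × ℝ}
    (hq : q ∈ f.source) (v : ℝ × ℝ) :
    ip (fderiv ℝ (fun q => binormal (x (f q)) (N (f q))) q v) (x (f q)) =
      -ip (binormal (x (f q)) (N (f q))) (fderiv ℝ (fun q => x (f q)) q v) := by
  have hβ := hasDerivAt_line (hf.differentiableAt_binormal hx hN hcone hq) v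
  have hX := hasDerivAt_line (hf.differentiableAt hx.smooth hq) v
  have h0 : q + (0 : ℝ) • v = q := by simp
  have h1 := (hβ.ip hX).unique ((hasDerivAt_const (0 : ℝ) (0 : ℝ)).congr_of_eventuallyEq
    (Filter.Eventually.of_forall fun τ => ip_binormal_left _ _))
  simp only [h0] at h1
  linarith

end IsSmoothParam

/-! ### Adapted coordinates -/

/-- `f` is a parametrization of a neighbourhood of `f (s₀, r₀)` by a rectangle, whose first
coordinate `s > 0` is the length of the position vector and whose second coordinate is
`-⟨e, x (f (s₀, r₀))⟩`, where `e` is the binormal field. -/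
structure IsAdapted (x N : M → E31) (f : OpenPartialHomeomorph (ℝ × ℝ) M)
    (a b c d s₀ r₀ : ℝ) : Prop where
  param : IsSmoothParam f
  source_eq : f.source = Set.Ioo a b ×ˢ Set.Ioo c d
  mem_left : s₀ ∈ Set.Ioo a b
  mem_right : r₀ ∈ Set.Ioo c d
  pos : ∀ s ∈ Set.Ioo a b, 0 < s
  ip_self : ∀ s ∈ Set.Ioo a b, ∀ r ∈ Set.Ioo c d, ip (x (f (s, r))) (x (f (s, r))) = s ^ 2
  ip_binormal : ∀ s ∈ Set.Ioo a b, ∀ r ∈ Set.Ioo c d,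
    r = -ip (binormal (x (f (s, r))) (N (f (s, r)))) (x (f (s₀, r₀)))

/-- Adapted coordinates exist around every point: a tangent vector annihilated by the
differentials of both coordinates is orthogonal to the position vector, the normal and the
binormal. -/
theorem exists_isAdapted [IsManifold (𝓡 2) ∞ M] (hx : IsSpacelikeImmersion x)
    (hN : IsUnitNormal x N) (hcone : ∀ p : M, 0 < ip (x p) (x p)) (p : M) :
    ∃ (f : OpenPartialHomeomorph (ℝ × ℝ) M) (a b c d s₀ r₀ : ℝ),
      f (s₀, r₀) = p ∧ IsAdapted x N f a b c d s₀ r₀ := by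
  obtain ⟨f, hf, hp⟩ := exists_isSmoothParam p
  obtain ⟨q₀, hq₀, rfl⟩ : ∃ q ∈ f.source, f q = p := ⟨_, f.map_target hp, f.right_inv hp⟩
  let H : ℝ × ℝ → ℝ × ℝ := fun q => (√(ip (x (f q)) (x (f q))),
    -ip (binormal (x (f q)) (N (f q))) (x (f q₀)))
  have hX := hf.contDiffOn hx.smooth
  have hH : ContDiffOn ℝ ∞ H f.source :=
    ((hX.ip hX).sqrt fun q _ => (hcone _).ne').prodMk
      ((hf.contDiffOn_binormal hx hN hcone).ip contDiffOn_const).neg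
  have hinj : ∀ v, fderiv ℝ H q₀ v = 0 → v = 0 := by
    intro v hv
    have hHd : DifferentiableAt ℝ H q₀ :=
      (hH.contDiffAt (f.open_source.mem_nhds hq₀)).differentiableAt (by simp)
    have hl := hasDerivAt_line hHd v
    have hXd := hasDerivAt_line (hf.differentiableAt hx.smooth hq₀) v
    have hβ := hasDerivAt_line (hf.differentiableAt_binormal hx hN hcone hq₀) v
    have h0 : q₀ + (0 : ℝ) • v = q₀ := by simp
    rw [hv] at hl
    have l1 : HasDerivAt (fun τ : ℝ => (H (q₀ + τ • v)).1) 0 0 :=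
      (ContinuousLinearMap.fst ℝ ℝ ℝ).hasFDerivAt.comp_hasDerivAt (0 : ℝ) hl
    have l2 : HasDerivAt (fun τ : ℝ => (H (q₀ + τ • v)).2) 0 0 :=
      (ContinuousLinearMap.snd ℝ ℝ ℝ).hasFDerivAt.comp_hasDerivAt (0 : ℝ) hl
    have h1 := l1.unique ((hXd.ip hXd).sqrt (hcone _).ne')
    have h2 := l2.unique ((hβ.ip (hasDerivAt_const (0 : ℝ) (x (f q₀)))).neg)
    have hs := Real.sqrt_pos.2 (hcone (f q₀))
    simp only [h0] at h1
    rw [eq_comm, div_eq_zero_iff] at h1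
    have h1' := h1.resolve_right (by positivity)
    rw [ip_comm (x (f q₀))] at h1'
    have h3 : ip (fderiv ℝ (fun q => x (f q)) q₀ v) (x (f q₀)) = 0 := by linarith
    have h4 : ip (fderiv ℝ (fun q => x (f q)) q₀ v) (N (f q₀)) = 0 := by
      rw [ip_comm]; exact hf.ip_fderiv_normal hx hN hq₀ v
    have h5 : ip (binormal (x (f q₀)) (N (f q₀))) (fderiv ℝ (fun q => x (f q)) q₀ v) = 0 := by
      have h6 := hf.ip_binormal_fderiv hx hN hcone hq₀ v
      have h7 : ip (binormal (x (f q₀)) (N (f q₀))) 0 = 0 := by rw [ip_comm, ip_zero_left]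
      simp only [h0, h7] at h2
      linarith
    by_contra hv0
    have h6 := hf.ip_fderiv_pos hx hq₀ hv0
    rw [eq_smul_binormal (hcone _) (hN.unit _) h3 h4, h5, zero_smul, ip_zero_left] at h6
    exact lt_irrefl _ h6
  obtain ⟨e, a, b, c, d, ρ, he, hes, hmem, hep, -, hρ⟩ :=
    hf.exists_reparam hH hq₀ hinj Filter.univ_mem
  have hm : H q₀ ∈ Set.Ioo a b ×ˢ Set.Ioo c d := hes ▸ hmem
  have hcoord : ∀ s ∈ Set.Ioo a b, ∀ r ∈ Set.Ioo c d,
      √(ip (x (e (s, r))) (x (e (s, r)))) = s ∧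
        -ip (binormal (x (e (s, r))) (N (e (s, r)))) (x (f q₀)) = r := by
    intro s hs r hr
    obtain ⟨-, -, h1, h2⟩ := hρ (s, r) (by rw [hes]; exact ⟨hs, hr⟩)
    rw [h1]
    exact Prod.ext_iff.1 h2
  have hpos : ∀ s ∈ Set.Ioo a b, 0 < s := fun s hs => by
    rw [← (hcoord s hs _ hm.2).1]
    exact Real.sqrt_pos.2 (hcone _)
  refine ⟨e, a, b, c, d, (H q₀).1, (H q₀).2, hep, he, hes, hm.1, hm.2, hpos, ?_, ?_⟩
  · intro s hs r hr
    rw [← (hcoord s hs r hr).1, Real.sq_sqrt (hcone _).le, (hcoord s hs r hr).1]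
  · intro s hs r hr
    change r = -ip _ (x (e (H q₀)))
    rw [hep]
    exact (hcoord s hs r hr).2.symm

end Surface

section Surface

variable {M : Type*} [TopologicalSpace M] [ChartedSpace (EuclideanSpace ℝ (Fin 2)) M]
  {x N : M → E31} {f : OpenPartialHomeomorph (ℝ × ℝ) M}

namespace IsAdapted

variable {a b c d s₀ r₀ : ℝ} (h : IsAdapted x N f a b c d s₀ r₀)
include h

theorem mem_source {s r : ℝ} (hs : s ∈ Set.Ioo a b) (hr : r ∈ Set.Ioo c d) :
    (s, r) ∈ f.source := by rw [h.source_eq]; exact ⟨hs, hr⟩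

theorem ip_fderiv_fst (hx : IsSpacelikeImmersion x) {s r : ℝ} (hs : s ∈ Set.Ioo a b)
    (hr : r ∈ Set.Ioo c d) :
    ip (x (f (s, r))) (fderiv ℝ (fun q => x (f q)) (s, r) (1, 0)) = s := by
  have h1 := hasDerivAt_fst (h.param.differentiableAt hx.smooth (h.mem_source hs hr))
  have h2 := (h1.ip h1).unique ((hasDerivAt_pow 2 s).congr_of_eventuallyEq
    (Filter.eventually_of_mem (isOpen_Ioo.mem_nhds hs) fun σ hσ => h.ip_self σ hσ r hr))
  rw [ip_comm (fderiv _ _ _ _)] at h2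
  norm_num at h2
  linarith

theorem ip_fderiv_snd (hx : IsSpacelikeImmersion x) {s r : ℝ} (hs : s ∈ Set.Ioo a b)
    (hr : r ∈ Set.Ioo c d) :
    ip (x (f (s, r))) (fderiv ℝ (fun q => x (f q)) (s, r) (0, 1)) = 0 := by
  have h1 := hasDerivAt_snd (h.param.differentiableAt hx.smooth (h.mem_source hs hr))
  have h2 := (h1.ip h1).unique ((hasDerivAt_const r (s ^ 2)).congr_of_eventuallyEq
    (Filter.eventually_of_mem (isOpen_Ioo.mem_nhds hr) fun ρ hρ => h.ip_self s hs ρ hρ))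
  rw [ip_comm (fderiv _ _ _ _)] at h2
  linarith

variable (hx : IsSpacelikeImmersion x) (hN : IsUnitNormal x N)
  (hcone : ∀ p : M, 0 < ip (x p) (x p))
include hx hN hcone

/-- The derivative of the second coordinate, computed from its definition by the binormal. -/
theorem snd_eq_ip_fderiv_binormal {s r : ℝ} (hs : s ∈ Set.Ioo a b) (hr : r ∈ Set.Ioo c d)
    (v : ℝ × ℝ) : v.2 = -ip (fderiv ℝ (fun q => binormal (x (f q)) (N (f q))) (s, r) v)
      (x (f (s₀, r₀))) := by
  have hq := h.mem_source hs hr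
  have h1 := hasDerivAt_line (h.param.differentiableAt_binormal hx hN hcone hq) v
  have h2 : HasDerivAt (fun τ : ℝ => ((s, r) + τ • v).2) v.2 0 := by
    simpa using ((hasDerivAt_id (0 : ℝ)).mul_const v.2).const_add r
  have hmem : ∀ᶠ τ : ℝ in nhds 0, (s, r) + τ • v ∈ f.source := by
    have hc : ContinuousAt (fun τ : ℝ => (s, r) + τ • v) 0 := by fun_prop
    exact hc.eventually (f.open_source.eventually_mem (by simpa using hq))
  have h3 := h2.unique ((h1.ip (hasDerivAt_const (0 : ℝ)
    (x (f (s₀, r₀))))).neg.congr_of_eventuallyEq (hmem.mono fun τ hτ => by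
      rw [h.source_eq] at hτ
      exact h.ip_binormal _ hτ.1 _ hτ.2))
  have h4 : ∀ w : E31, ip w 0 = 0 := fun w => by rw [ip_comm, ip_zero_left]
  rw [h4, add_zero] at h3
  exact h3

variable (hG : IsGCR x N)
include hG

/-- In adapted coordinates on a GCR surface the first coordinate direction is that of the
tangential part of the position vector, since the binormal field, hence also the second
coordinate, is constant in that principal direction. By self-adjointness of the shape operator,
`⟨x, N⟩` does not change in the second coordinate direction. -/
theorem fderiv_eq {s r : ℝ} (hs : s ∈ Set.Ioo a b) (hr : r ∈ Set.Ioo c d) :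
    fderiv ℝ (fun q => x (f q)) (s, r) (1, 0) =
        (s / (s ^ 2 + ip (x (f (s, r))) (N (f (s, r))) ^ 2)) •
          (x (f (s, r)) + ip (x (f (s, r))) (N (f (s, r))) • N (f (s, r))) ∧
      fderiv ℝ (fun q => binormal (x (f q)) (N (f q))) (s, r) (1, 0) = 0 ∧
      ip (x (f (s, r))) (fderiv ℝ (fun q => N (f q)) (s, r) (0, 1)) = 0 := by
  have hq := h.mem_source hs hr
  obtain ⟨v, k, hv0, hv, hk⟩ := h.param.exists_fderiv_eq_of_isGCR hx hN hG hq
  have hβ := h.param.fderiv_binormal_eq_zero hx hN hcone hq hv hk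
  have hv2 : v.2 = 0 := by
    rw [h.snd_eq_ip_fderiv_binormal hx hN hcone hs hr v, hβ, ip_zero_left, neg_zero]
  have hve : v = v.1 • ((1 : ℝ), (0 : ℝ)) := by ext <;> simp [hv2]
  have hα : v.1 ≠ 0 := fun h0 => hv0 (Prod.ext h0 hv2)
  have hXs := h.ip_fderiv_fst hx hs hr
  have hXr := h.ip_fderiv_snd hx hs hr
  have hXX := h.ip_self s hs r hr
  have hn := h.param.ip_fderiv_normal hx hN hq (0, 1)
  have hnn := h.param.ip_normal_fderiv_normal hN hq (0, 1)
  have hs0 := h.pos s hs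
  have hcomm := h.param.ip_fderiv_comm hx hN hq v (0, 1)
  set X := x (f (s, r))
  set n := N (f (s, r))
  set g := ip X n with hg
  refine ⟨?_, ?_, ?_⟩
  · have h1 := hv
    rw [hve, map_smul] at h1
    have h2 : v.1 * s = s ^ 2 + g ^ 2 := by
      have h4 : v.1 * s = ip X (X + g • n) := by rw [← h1, ip_smul_right, hXs]
      rw [h4, ip_add_right, ip_smul_right, hXX, ← hg]; ring
    have h3 : s / (s ^ 2 + g ^ 2) = v.1⁻¹ := by rw [← h2]; field_simp
    rw [h3, ← h1, smul_smul, inv_mul_cancel₀ hα, one_smul]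
  · rw [hve, map_smul] at hβ
    exact (smul_eq_zero.1 hβ).resolve_left hα
  · rw [hk, hv, ip_neg_left, ip_smul_left, ip_add_left, ip_smul_left, hXr, hn, ip_add_right,
      ip_smul_right, ip_comm _ n, hnn, ip_comm _ X] at hcomm
    linarith

/-- On a GCR surface `⟨x, N⟩` depends only on the length of the position vector. -/
theorem ip_normal_eq {s r : ℝ} (hs : s ∈ Set.Ioo a b) (hr : r ∈ Set.Ioo c d) :
    ip (x (f (s, r))) (N (f (s, r))) = ip (x (f (s, r₀))) (N (f (s, r₀))) := by
  refine eq_of_hasDerivAt_zero (g := fun ρ => ip (x (f (s, ρ))) (N (f (s, ρ))))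
    (fun ρ hρ => ?_) hr h.mem_right
  have hq := h.mem_source hs hρ
  refine ((hasDerivAt_snd (h.param.differentiableAt hx.smooth hq)).ip
    (hasDerivAt_snd (h.param.differentiableAt hN.smooth hq))).congr_deriv ?_
  rw [(h.fderiv_eq hx hN hcone hG hs hρ).2.2, ip_comm (fderiv _ _ _ _),
    h.param.ip_fderiv_normal hx hN hq, add_zero]

theorem binormal_eq {s r : ℝ} (hs : s ∈ Set.Ioo a b) (hr : r ∈ Set.Ioo c d) :
    binormal (x (f (s, r))) (N (f (s, r))) = binormal (x (f (s₀, r))) (N (f (s₀, r))) := by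
  refine eq_of_hasDerivAt_zero (g := fun σ => binormal (x (f (σ, r))) (N (f (σ, r))))
    (fun σ hσ => ?_) hs h.mem_left
  have h1 := hasDerivAt_fst (h.param.differentiableAt_binormal hx hN hcone (h.mem_source hσ hr))
  rwa [(h.fderiv_eq hx hN hcone hG hσ hr).2.1] at h1

/-- There are smooth functions `θ`, `u` of the first coordinate with `⟨x, N⟩ = -s sinh θ` and
`s u' = tanh θ`. -/
theorem exists_theta_u : ∃ θ u : ℝ → ℝ, ContDiffOn ℝ ∞ θ (Set.Ioo a b) ∧
    ContDiffOn ℝ ∞ u (Set.Ioo a b) ∧ u s₀ = 0 ∧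
    (∀ s ∈ Set.Ioo a b, HasDerivAt u (Real.tanh (θ s) / s) s) ∧
    ∀ s ∈ Set.Ioo a b, ∀ r ∈ Set.Ioo c d,
      ip (x (f (s, r))) (N (f (s, r))) = -(s * Real.sinh (θ s)) := by
  have hg : ContDiffOn ℝ ∞ (fun s => ip (x (f (s, r₀))) (N (f (s, r₀)))) (Set.Ioo a b) :=
    ((h.param.contDiffOn hx.smooth).ip (h.param.contDiffOn hN.smooth)).comp
      (contDiffOn_id.prodMk contDiffOn_const) fun s hs => h.mem_source hs h.mem_right
  let θ : ℝ → ℝ := fun s => Real.arsinh (-(ip (x (f (s, r₀))) (N (f (s, r₀))) / s))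
  have hθ : ContDiffOn ℝ ∞ θ (Set.Ioo a b) :=
    (hg.div contDiffOn_id fun s hs => (h.pos s hs).ne').neg.arsinh
  have hT : ContDiffOn ℝ ∞ (fun s => Real.tanh (θ s) / s) (Set.Ioo a b) := by
    refine ContDiffOn.div ?_ contDiffOn_id fun s hs => (h.pos s hs).ne'
    simp only [Real.tanh_eq_sinh_div_cosh]
    exact hθ.sinh.div hθ.cosh fun s _ => (Real.cosh_pos _).ne'
  obtain ⟨u, hu, hu0, hu'⟩ := exists_smooth_antideriv h.mem_left hT
  refine ⟨θ, u, hθ, hu, hu0, hu', fun s hs r hr => ?_⟩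
  have := h.pos s hs
  rw [h.ip_normal_eq hx hN hcone hG hs hr, Real.sinh_arsinh]
  field_simp

omit hx hN hcone hG in
/-- The time-like vector completing the unit position vector and the binormal to an orthonormal
frame, in terms of the position vector and the normal. -/
theorem wedge_binormal {s r θ : ℝ} (hs : s ∈ Set.Ioo a b) (hr : r ∈ Set.Ioo c d)
    (hθ : ip (x (f (s, r))) (N (f (s, r))) = -(s * Real.sinh θ)) :
    wedge (s⁻¹ • x (f (s, r))) (binormal (x (f (s, r))) (N (f (s, r)))) =
      -((Real.cosh θ)⁻¹ • (Real.sinh θ • s⁻¹ • x (f (s, r)) + N (f (s, r)))) := by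
  have hs0 := h.pos s hs
  have hc := Real.cosh_pos θ
  have hD : √(ip (x (f (s, r))) (x (f (s, r))) + ip (x (f (s, r))) (N (f (s, r))) ^ 2) =
      s * Real.cosh θ := by
    rw [← Real.sqrt_sq (by positivity : 0 ≤ s * Real.cosh θ), h.ip_self s hs r hr, hθ]
    congr 1
    linear_combination -s ^ 2 * Real.cosh_sq θ
  rw [binormal, hD, wedge_smul_left, wedge_smul_right, wedge_wedge, hθ, h.ip_self s hs r hr]
  match_scalars <;> field_simp

/-- In the first coordinate direction the unit position vector turns hyperbolically, at the
rate `tanh θ / s`, in the plane orthogonal to the constant binormal. -/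
theorem hasDerivAt_unit_position {θ : ℝ → ℝ}
    (hθ : ∀ s ∈ Set.Ioo a b, ∀ r ∈ Set.Ioo c d,
      ip (x (f (s, r))) (N (f (s, r))) = -(s * Real.sinh (θ s))) {s r : ℝ}
    (hs : s ∈ Set.Ioo a b) (hr : r ∈ Set.Ioo c d) :
    HasDerivAt (fun σ => σ⁻¹ • x (f (σ, r)))
      ((Real.tanh (θ s) / s) • wedge (s⁻¹ • x (f (s, r)))
        (binormal (x (f (s, r))) (N (f (s, r))))) s := by
  have hs0 := h.pos s hs
  have hc := Real.cosh_pos (θ s)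
  refine ((hasDerivAt_inv hs0.ne').smul (hasDerivAt_fst
    (h.param.differentiableAt hx.smooth (h.mem_source hs hr)))).congr_deriv ?_
  have hden : s ^ 2 + (-(s * Real.sinh (θ s))) ^ 2 = (s * Real.cosh (θ s)) ^ 2 := by
    linear_combination -s ^ 2 * Real.cosh_sq (θ s)
  rw [h.wedge_binormal hs hr (hθ s hs r hr),
    (h.fderiv_eq hx hN hcone hG hs hr).1, hθ s hs r hr, hden, Real.tanh_eq_sinh_div_cosh]
  match_scalars
  · field_simp
    linear_combination -Real.cosh_sq (θ s)
  · field_simp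

/-- The conic form of the position vector, with the curve of unit position vectors over `s = s₀`
in place of `φ` and the binormal in place of `φ'`: undoing the hyperbolic rotation by the angle `u`
gives a vector independent of the first coordinate. -/
theorem position_eq {θ u : ℝ → ℝ} (hu0 : u s₀ = 0)
    (hu : ∀ s ∈ Set.Ioo a b, HasDerivAt u (Real.tanh (θ s) / s) s)
    (hθ : ∀ s ∈ Set.Ioo a b, ∀ r ∈ Set.Ioo c d,
      ip (x (f (s, r))) (N (f (s, r))) = -(s * Real.sinh (θ s))) {s r : ℝ}
    (hs : s ∈ Set.Ioo a b) (hr : r ∈ Set.Ioo c d) :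
    x (f (s, r)) = s • (Real.cosh (u s) • s₀⁻¹ • x (f (s₀, r)) + Real.sinh (u s) •
      wedge (s₀⁻¹ • x (f (s₀, r))) (binormal (x (f (s₀, r))) (N (f (s₀, r))))) := by
  set B := binormal (x (f (s₀, r))) (N (f (s₀, r)))
  have hBs : ∀ σ ∈ Set.Ioo a b, binormal (x (f (σ, r))) (N (f (σ, r))) = B := fun σ hσ =>
    h.binormal_eq hx hN hcone hG hσ hr
  have hww : ∀ σ ∈ Set.Ioo a b,
      wedge (wedge (σ⁻¹ • x (f (σ, r))) B) B = σ⁻¹ • x (f (σ, r)) := by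
    intro σ hσ
    rw [wedge_smul_left, wedge_smul_left, ← hBs σ hσ,
      wedge_wedge_binormal (hcone _) (hN.unit _)]
  have hconst := eq_of_hasDerivAt_zero (g := fun σ => Real.cosh (u σ) • σ⁻¹ • x (f (σ, r)) -
    Real.sinh (u σ) • wedge (σ⁻¹ • x (f (σ, r))) B) (fun σ hσ => by
      have h1 := h.hasDerivAt_unit_position hx hN hcone hG hθ hσ hr
      rw [hBs σ hσ] at h1
      have h2 := h1.wedge (hasDerivAt_const σ B)
      refine (((hu σ hσ).cosh.smul h1).sub ((hu σ hσ).sinh.smul h2)).congr_deriv ?_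
      have h3 : wedge (σ⁻¹ • x (f (σ, r))) 0 = 0 := by
        ext i; fin_cases i <;> simp [wedge]
      rw [wedge_smul_left (Real.tanh (θ σ) / σ), hww σ hσ, h3]
      module) hs h.mem_left
  simp only [hu0, Real.cosh_zero, Real.sinh_zero, one_smul, zero_smul, sub_zero] at hconst
  have hxY : x (f (s, r)) = s • (s⁻¹ • x (f (s, r))) := by
    rw [smul_smul, mul_inv_cancel₀ (h.pos s hs).ne', one_smul]
  refine hxY.trans (congrArg (s • ·) ?_)
  have hY := hww s hs
  generalize s⁻¹ • x (f (s, r)) = Y at hY hconst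
  rw [← hconst, sub_eq_add_neg, wedge_add_left, ← neg_smul, wedge_smul_left, wedge_smul_left, hY]
  calc Y = (Real.cosh (u s) ^ 2 - Real.sinh (u s) ^ 2) • Y := by
        rw [Real.cosh_sq, add_sub_cancel_left, one_smul]
    _ = _ := by module

end IsAdapted

/-- On a GCR surface the decomposition of the position vector holds for the given unit normal as
soon as `⟨x, N⟩ = -s sinh θ`, where `s > 0` is the length of the position vector. -/
theorem IsGCR.hasDecomposition (hN : IsUnitNormal x N) (hG : IsGCR x N) {a b c d : ℝ}
    {θ u : ℝ → ℝ} (hs : ∀ s ∈ Set.Ioo a b, 0 < s) (hθ : ContDiffOn ℝ ∞ θ (Set.Ioo a b))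
    (hu : ∀ s ∈ Set.Ioo a b, Real.tanh (θ s) = s * deriv u s)
    (hx : ∀ s ∈ Set.Ioo a b, ∀ t ∈ Set.Ioo c d, ip (x (f (s, t))) (x (f (s, t))) = s ^ 2 ∧
      ip (x (f (s, t))) (N (f (s, t))) = -(s * Real.sinh (θ s))) :
    HasDecomposition x N f a b c d u := by
  refine ⟨θ, hθ, hu, fun s hs' t ht => ?_⟩
  obtain ⟨v, hv1, hv2⟩ := hG (f (s, t))
  obtain ⟨h1, h2⟩ := hx s hs' t ht
  have hs0 := hs s hs'
  have hc := Real.cosh_pos (θ s)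
  have hsc : s * Real.cosh (θ s) ≠ 0 := by positivity
  have hcs := Real.cosh_sq (θ s)
  refine ⟨(s * Real.cosh (θ s))⁻¹ • v, ?_, hv2.smul (inv_ne_zero hsc), ?_⟩
  · rw [map_smul, hv1, tangentialPart, h2]
    simp only [ip_smul_left, ip_smul_right, ip_add_left, ip_add_right, h1, h2, hN.unit,
      ip_comm (N (f (s, t))) (x (f (s, t)))]
    field_simp
    linear_combination -hcs
  · rw [map_smul, hv1, tangentialPart, h2]
    match_scalars <;> field_simp
    ring

end Surface

/-! ### Conic parametrizations of GCR surfaces -/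

section Surface

variable {M : Type*} [TopologicalSpace M] [ChartedSpace (EuclideanSpace ℝ (Fin 2)) M]
  {x N : M → E31} {f : OpenPartialHomeomorph (ℝ × ℝ) M} {a b c d s₀ r₀ : ℝ}

/-- Along the curve `s = s₀`, the velocity of the unit position vector is a multiple of the
binormal, and the factor is positive at `r₀` because of the choice of the second coordinate. -/
theorem IsAdapted.exists_speed (h : IsAdapted x N f a b c d s₀ r₀)
    (hx : IsSpacelikeImmersion x) (hN : IsUnitNormal x N)
    (hcone : ∀ p : M, 0 < ip (x p) (x p)) :
    ∃ v : ℝ → ℝ, ContDiffOn ℝ ∞ v (Set.Ioo c d) ∧ 0 < v r₀ ∧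
      ∀ r ∈ Set.Ioo c d, HasDerivAt (fun ρ => s₀⁻¹ • x (f (s₀, ρ)))
        (v r • binormal (x (f (s₀, r))) (N (f (s₀, r)))) r := by
  have hmaps : Set.MapsTo (fun r => (s₀, r)) (Set.Ioo c d) f.source := fun r hr =>
    h.mem_source h.mem_left hr
  have hX₀ : ContDiffOn ℝ ∞ (fun ρ => x (f (s₀, ρ))) (Set.Ioo c d) :=
    (h.param.contDiffOn hx.smooth).comp (contDiffOn_const.prodMk contDiffOn_id) hmaps
  have hX : ContDiffOn ℝ ∞ (fun ρ => s₀⁻¹ • x (f (s₀, ρ))) (Set.Ioo c d) :=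
    hX₀.const_smul s₀⁻¹
  have hB : ContDiffOn ℝ ∞ (fun ρ => binormal (x (f (s₀, ρ))) (N (f (s₀, ρ)))) (Set.Ioo c d) :=
    (h.param.contDiffOn_binormal hx hN hcone).comp (contDiffOn_const.prodMk contDiffOn_id) hmaps
  have hd : ∀ r ∈ Set.Ioo c d, HasDerivAt (fun ρ => s₀⁻¹ • x (f (s₀, ρ)))
      (s₀⁻¹ • fderiv ℝ (fun q => x (f q)) (s₀, r) (0, 1)) r := fun r hr =>
    (hasDerivAt_snd (h.param.differentiableAt hx.smooth (hmaps hr))).const_smul s₀⁻¹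
  refine ⟨_, hB.ip ((contDiffOn_infty_iff_deriv_of_isOpen isOpen_Ioo).1 hX).2, ?_, ?_⟩
  · have h1 := h.snd_eq_ip_fderiv_binormal hx hN hcone h.mem_left h.mem_right (0, 1)
    rw [h.param.ip_binormal_fderiv hx hN hcone (hmaps h.mem_right), neg_neg] at h1
    rw [(hd r₀ h.mem_right).deriv, ip_smul_right, ← h1, mul_one]
    exact inv_pos.2 (h.pos _ h.mem_left)
  · intro r hr
    have h1 := hd r hr
    rw [h1.deriv]
    rwa [eq_smul_binormal (hcone (f (s₀, r))) (hN.unit (f (s₀, r)))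
      (v := s₀⁻¹ • fderiv ℝ (fun q => x (f q)) (s₀, r) (0, 1))
      (by rw [ip_smul_left, ip_comm, h.ip_fderiv_snd hx h.mem_left hr, mul_zero])
      (by rw [ip_smul_left, ip_comm, h.param.ip_fderiv_normal hx hN (hmaps hr), mul_zero])] at h1

/-- Around every point of a GCR surface there is a conic parametrization with `s > 0` for which
the decomposition of the position vector holds with the given unit normal: in adapted
coordinates, replace the second coordinate by the arc length of the curve of unit position
vectors over `s = s₀`. -/
theorem IsGCR.exists_conic [IsManifold (𝓡 2) ∞ M] (hx : IsSpacelikeImmersion x)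
    (hN : IsUnitNormal x N) (hcone : ∀ p : M, 0 < ip (x p) (x p)) (hG : IsGCR x N) (p : M) :
    ∃ (f : OpenPartialHomeomorph (ℝ × ℝ) M) (a b c d : ℝ) (u : ℝ → ℝ) (φ : ℝ → E31),
      p ∈ f.target ∧ 0 ≤ a ∧ IsConicParametrization x f a b c d u φ ∧
      HasDecomposition x N f a b c d u := by
  obtain ⟨f, a, b, c, d, s₀, r₀, rfl, h⟩ := exists_isAdapted hx hN hcone p
  obtain ⟨θ, u, hθ, hu, hu0, hu', hgθ⟩ := h.exists_theta_u hx hN hcone hG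
  obtain ⟨v, hv, hv0, hΦ⟩ := h.exists_speed hx hN hcone
  obtain ⟨T, hT, -, hT'⟩ := exists_smooth_antideriv h.mem_right hv
  obtain ⟨c', d', hr₀, hsub, hvpos⟩ : ∃ c' d', r₀ ∈ Set.Ioo c' d' ∧
      Set.Ioo c' d' ⊆ Set.Ioo c d ∧ ∀ r ∈ Set.Ioo c' d', 0 < v r := by
    have h1 : ∀ᶠ r in nhds r₀, r ∈ Set.Ioo c d ∧ 0 < v r :=
      (isOpen_Ioo.eventually_mem h.mem_right).and
        ((hv.continuousOn.continuousAt (isOpen_Ioo.mem_nhds h.mem_right)).eventually_const_lt hv0)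
    obtain ⟨c', d', hr₀, hsub⟩ := mem_nhds_iff_exists_Ioo_subset.1 h1
    exact ⟨c', d', hr₀, fun r hr => (hsub hr).1, fun r hr => (hsub hr).2⟩
  -- the arc length function `T` is injective near `r₀`
  have hTinj : Set.InjOn T (Set.Ioo c' d') := by
    refine (strictMonoOn_of_deriv_pos (convex_Ioo _ _) (fun r hr =>
      (hT' r (hsub hr)).continuousAt.continuousWithinAt) fun r hr => ?_).injOn
    rw [interior_Ioo] at hr
    rw [(hT' r (hsub hr)).deriv]
    exact hvpos r hr
  have hq₀ := h.mem_source h.mem_left h.mem_right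
  have hsnd : Set.MapsTo (Prod.snd : ℝ × ℝ → ℝ) f.source (Set.Ioo c d) := fun q hq => by
    rw [h.source_eq] at hq; exact hq.2
  have hH : ContDiffOn ℝ ∞ (fun q : ℝ × ℝ => (q.1, T q.2)) f.source :=
    contDiffOn_fst.prodMk (hT.comp contDiffOn_snd hsnd)
  have hinj : ∀ w, fderiv ℝ (fun q : ℝ × ℝ => (q.1, T q.2)) (s₀, r₀) w = 0 → w = 0 := by
    intro w hw
    have h1 : HasFDerivAt (fun q : ℝ × ℝ => T q.2) _ (s₀, r₀) :=
      (hT' r₀ h.mem_right).comp_hasFDerivAt (s₀, r₀) (hasFDerivAt_snd (𝕜 := ℝ))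
    have h2 := (hasFDerivAt_fst (𝕜 := ℝ) (p := ((s₀, r₀) : ℝ × ℝ))).prodMk h1
    rw [h2.fderiv] at hw
    have h3 := congrArg Prod.fst hw
    have h4 := congrArg Prod.snd hw
    simp at h3 h4
    exact Prod.ext h3 (h4.resolve_left hv0.ne')
  obtain ⟨e, a', b', c'', d'', ρ, he, hes, hmem, hep, hρ, hρe⟩ := h.param.exists_reparam hH hq₀
    hinj (W := Set.univ ×ˢ Set.Ioo c' d') (prod_mem_nhds Filter.univ_mem (isOpen_Ioo.mem_nhds hr₀))
  have hm : (s₀, T r₀) ∈ Set.Ioo a' b' ×ˢ Set.Ioo c'' d'' := hes ▸ hmem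
  -- the inverse of `T`, read off from the change of coordinates; it is independent of `s`
  let R : ℝ → ℝ := fun t => (ρ (s₀, t)).2
  have hρ' : ∀ s ∈ Set.Ioo a' b', ∀ t ∈ Set.Ioo c'' d'', s ∈ Set.Ioo a b ∧
      (ρ (s, t)).2 ∈ Set.Ioo c' d' ∧ (ρ (s, t)).1 = s ∧ T (ρ (s, t)).2 = t := by
    intro s hs t ht
    obtain ⟨h1, h2, -, h3⟩ := hρe (s, t) (by rw [hes]; exact ⟨hs, ht⟩)
    rw [h.source_eq] at h1
    have h4 := congrArg Prod.fst h3
    have h5 := congrArg Prod.snd h3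
    simp only at h4 h5
    exact ⟨h4 ▸ h1.1, h2.2, h4, h5⟩
  have hR : ∀ t ∈ Set.Ioo c'' d'', R t ∈ Set.Ioo c' d' ∧ T (R t) = t := fun t ht =>
    ⟨(hρ' s₀ hm.1 t ht).2.1, (hρ' s₀ hm.1 t ht).2.2.2⟩
  have hsa : ∀ s ∈ Set.Ioo a' b', s ∈ Set.Ioo a b := fun s hs => (hρ' s hs _ hm.2).1
  have heq : ∀ s ∈ Set.Ioo a' b', ∀ t ∈ Set.Ioo c'' d'', e (s, t) = f (s, R t) := by
    intro s hs t ht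
    obtain ⟨-, h2, h3, h4⟩ := hρ' s hs t ht
    have h5 : (ρ (s, t)).2 = R t := hTinj h2 (hR t ht).1 (h4.trans (hR t ht).2.symm)
    rw [(hρe (s, t) (by rw [hes]; exact ⟨hs, ht⟩)).2.2.1]
    exact congrArg f (Prod.ext h3 h5)
  have hRs : ContDiffOn ℝ ∞ R (Set.Ioo c'' d'') :=
    contDiff_snd.comp_contDiffOn (hρ.comp (contDiffOn_const.prodMk contDiffOn_id) fun t ht => by
      rw [hes]; exact ⟨hm.1, ht⟩)
  have hR' : ∀ t ∈ Set.Ioo c'' d'', HasDerivAt R (v (R t))⁻¹ t := by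
    intro t ht
    have h1 : HasDerivAt R (deriv R t) t :=
      ((hRs.contDiffAt (isOpen_Ioo.mem_nhds ht)).differentiableAt (by simp)).hasDerivAt
    have h2 := ((hT' _ (hsub (hR t ht).1)).comp t h1).unique
      ((hasDerivAt_id t).congr_of_eventuallyEq
        (Filter.eventually_of_mem (isOpen_Ioo.mem_nhds ht) fun τ hτ => (hR τ hτ).2))
    rwa [← eq_inv_of_mul_eq_one_right h2]
  let φ : ℝ → E31 := fun t => s₀⁻¹ • x (f (s₀, R t))
  have hφ' : ∀ t ∈ Set.Ioo c'' d'',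
      deriv φ t = binormal (x (f (s₀, R t))) (N (f (s₀, R t))) := by
    intro t ht
    have h1 := (hΦ _ (hsub (hR t ht).1)).scomp t (hR' t ht)
    rw [smul_smul, inv_mul_cancel₀ (hvpos _ (hR t ht).1).ne', one_smul] at h1
    exact h1.deriv
  have hpos : ∀ s ∈ Set.Ioo a' b', 0 < s := fun s hs => h.pos s (hsa s hs)
  have hs₀ := h.pos s₀ h.mem_left
  refine ⟨e, a', b', c'', d'', u, φ, ?_, ?_, ⟨hm.1.1.trans hm.1.2, hm.2.1.trans hm.2.2, hes,
    he.smooth, he.smooth_symm, hu.mono hsa, ?_, ?_, ?_, ?_⟩, ?_⟩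
  · rw [← hep]; exact e.map_source hmem
  · by_contra! ha
    linarith [hpos (a' / 2) ⟨by linarith, by linarith [hm.1.2, hs₀]⟩]
  · have hX : ContDiffOn ℝ ∞ (fun t => x (f (s₀, R t))) (Set.Ioo c'' d'') :=
      (h.param.contDiffOn hx.smooth).comp (contDiffOn_const.prodMk hRs) fun t ht =>
        h.mem_source h.mem_left (hsub (hR t ht).1)
    exact hX.const_smul s₀⁻¹
  · intro t ht
    rw [ip_smul_left, ip_smul_right, h.ip_self s₀ h.mem_left _ (hsub (hR t ht).1)]
    field_simp
  · intro t ht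
    rw [hφ' t ht]
    exact ip_binormal_self (hcone _) (hN.unit _)
  · intro s hs t ht
    rw [hφ' t ht, heq s hs t ht]
    exact h.position_eq hx hN hcone hG hu0 hu' hgθ (hsa s hs) (hsub (hR t ht).1)
  · refine hG.hasDecomposition hN hpos (hθ.mono hsa) (fun s hs => ?_) fun s hs t ht => ?_
    · have := hpos s hs
      rw [(hu' s (hsa s hs)).deriv]
      field_simp
    · rw [heq s hs t ht]
      exact ⟨h.ip_self s (hsa s hs) _ (hsub (hR t ht).1),
        hgθ s (hsa s hs) _ (hsub (hR t ht).1)⟩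

end Surface

end Minkowski

end

theorem mainTheorem2 {M : Type*} [TopologicalSpace M]
    [ChartedSpace (EuclideanSpace ℝ (Fin 2)) M] [IsManifold (𝓡 2) ∞ M]
    (x N : M → Minkowski.E31)
    (hx : Minkowski.IsSpacelikeImmersion x) (hN : Minkowski.IsUnitNormal x N)
    (hcone : ∀ p : M, 0 < Minkowski.ip (x p) (x p)) :
    -- the characterization
    (Minkowski.IsGCR x N ↔
      ∀ p : M, ∃ (f : OpenPartialHomeomorph (ℝ × ℝ) M) (a b c d : ℝ) (u : ℝ → ℝ)
        (φ : ℝ → Minkowski.E31),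
        p ∈ f.target ∧ Minkowski.IsConicParametrization x f a b c d u φ) ∧
    -- every such parametrization has the decomposition, for one of the two unit normals
    (∀ (f : OpenPartialHomeomorph (ℝ × ℝ) M) (a b c d : ℝ) (u : ℝ → ℝ)
        (φ : ℝ → Minkowski.E31), Minkowski.IsConicParametrization x f a b c d u φ →
        Minkowski.HasDecomposition x N f a b c d u ∨
        Minkowski.HasDecomposition x (fun q => -N q) f a b c d u) ∧
    -- and for the given unit normal the parametrization can be so chosen, with `s > 0`
    (Minkowski.IsGCR x N →
      ∀ p : M, ∃ (f : OpenPartialHomeomorph (ℝ × ℝ) M) (a b c d : ℝ) (u : ℝ → ℝ)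
        (φ : ℝ → Minkowski.E31),
        p ∈ f.target ∧ 0 ≤ a ∧ Minkowski.IsConicParametrization x f a b c d u φ ∧
        Minkowski.HasDecomposition x N f a b c d u) := by
  refine ⟨⟨fun hG p => ?_, Minkowski.isGCR_of_conic hx hN hcone⟩,
    fun f a b c d u φ h => h.hasDecomposition_or hx hN, fun hG => hG.exists_conic hx hN hcone⟩
  obtain ⟨f, a, b, c, d, u, φ, hp, -, h, -⟩ := hG.exists_conic hx hN hcone p
  exact ⟨f, a, b, c, d, u, φ, hp, h⟩
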